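/- Let $\gamma_1,\gamma_2:[0,1)\to\mathbb{R}^n$ be continuous semialgebraic curves (that is, their graphs are semialgebraic subsets of $\mathbb{R}^{n+1}$) with $\gamma_1(0)=\gamma_2(0)=0$. Assume that neither is constant on any interval $[0,\delta)$, $\delta>0$, and that the two curves, identified with the images $\gamma_i([0,\varepsilon))$ for small $\varepsilon>0$, define distinct set germs at $0$. For $X\subset\mathbb{R}^n$ and $x,y\in X$ let $d_l(x,y)\in[0,\infty]$ be the infimum of the lengths of the rectifiable paths in $X$ joining $x$ to $y$. The set $X$ is *normally embedded* if there is $C>0$ with $d_l(x,y)\le C\|x-y\|$ for all $x,y\in X$, and the germ $(X,0)$ is *normally embedded* if $X\cap U$ is normally embedded for some neighbourhood $U$ of $0$. The *Peano tangent cone* of $X$ at $0$ is the set $C_0(X)$ of all $v=\lim_\nu t_\nu x_\nu$ with $t_\nu>0$, $x_\nu\in X$, $x_\nu\to 0$. Then there are closed half-lines $l_1,l_2$ with endpoint $0$ (the tangent half-lines of $\gamma_1,\gamma_2$ at $0$) such that, for all sufficiently small $\varepsilon>0$, $C_0(\gamma_i([0,\varepsilon)))=l_i$ for $i=1,2$,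 and $$\text{the germ } \bigl(\gamma_1([0,\varepsilon))\cup\gamma_2([0,\varepsilon)),\,0\bigr)\text{ is normally embedded}\iff l_1\neq l_2 .$$ -/

import Mathlib

open Filter Topology Set
open scoped NNReal ENNReal

/-- Semialgebraic subsets of `ℝ^σ`: the smallest class of subsets containing all sets
`{x | 0 < p x}`, with `p` a real polynomial, and closed under complements and finite unions
(hence also under finite intersections). -/
inductive IsSemialgebraic {σ : Type} : Set (σ → ℝ) → Prop
  | pos (p : MvPolynomial σ ℝ) : IsSemialgebraic {x | 0 < MvPolynomial.eval x p}
  | compl {S : Set (σ → ℝ)} : IsSemialgebraic S → IsSemialgebraic Sᶜ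
  | union {S T : Set (σ → ℝ)} : IsSemialgebraic S → IsSemialgebraic T → IsSemialgebraic (S ∪ T)

/-- The graph of `γ` restricted to `[0,1)`, as a subset of `ℝ × ℝⁿ = ℝ^{n+1}`
(the coordinate `0` is the parameter). -/
def curveGraph {n : ℕ} (γ : ℝ → EuclideanSpace ℝ (Fin n)) : Set (Fin (n + 1) → ℝ) :=
  {x | x 0 ∈ Ico (0 : ℝ) 1 ∧ ∀ i : Fin n, x i.succ = γ (x 0) i}

/-- `γ` restricts to a semialgebraic curve `[0,1) → ℝⁿ` starting at the origin: it is continuous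
and its graph is a semialgebraic set. (Values of `γ` outside `[0,1)` are irrelevant.) -/
structure IsSemialgebraicCurve {n : ℕ} (γ : ℝ → EuclideanSpace ℝ (Fin n)) : Prop where
  continuousOn : ContinuousOn γ (Ico 0 1)
  semialgebraic_graph : IsSemialgebraic (curveGraph γ)
  map_zero : γ 0 = 0

/-- The germ at `0` of the curve `γ` is not constant. -/
def NonconstantGerm {n : ℕ} (γ : ℝ → EuclideanSpace ℝ (Fin n)) : Prop :=
  ∃ᶠ t in 𝓝[>] (0 : ℝ), γ t ≠ γ 0

/-- The image `γ([0,ε))`. For small `ε > 0` it represents the germ of the curve at `γ 0`. -/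
def arc {n : ℕ} (γ : ℝ → EuclideanSpace ℝ (Fin n)) (ε : ℝ) : Set (EuclideanSpace ℝ (Fin n)) :=
  γ '' Ico 0 ε

/-- The sets `X` and `Y` have the same germ at `a`. -/
def SameGermAt {n : ℕ} (X Y : Set (EuclideanSpace ℝ (Fin n))) (a : EuclideanSpace ℝ (Fin n)) :
    Prop :=
  ∀ᶠ x in 𝓝 a, x ∈ X ↔ x ∈ Y

/-- The length metric `d_l` of `X`: the infimum of the lengths of the paths `[0,1] → X` from `x`
to `y`. It takes values in `[0,∞]`; non-rectifiable paths have length `∞`, so they do not affect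
the infimum, which is `∞` exactly when no rectifiable path in `X` joins `x` to `y`. -/
noncomputable def innerEDist {n : ℕ} (X : Set (EuclideanSpace ℝ (Fin n)))
    (x y : EuclideanSpace ℝ (Fin n)) : ℝ≥0∞ :=
  ⨅ (c : ℝ → EuclideanSpace ℝ (Fin n)) (_ : ContinuousOn c (Icc 0 1)) (_ : MapsTo c (Icc 0 1) X)
    (_ : c 0 = x) (_ : c 1 = y), eVariationOn c (Icc 0 1)

/-- `X` is Lipschitz normally embedded: the length metric is bounded by a constant multiple
of the Euclidean metric. -/
def IsLNE {n : ℕ} (X : Set (EuclideanSpace ℝ (Fin n))) : Prop :=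
  ∃ C : ℝ≥0, 0 < C ∧ ∀ x ∈ X, ∀ y ∈ X, innerEDist X x y ≤ C * edist x y

/-- The germ of `X` at `a` is normally embedded. -/
def IsGermLNE {n : ℕ} (X : Set (EuclideanSpace ℝ (Fin n))) (a : EuclideanSpace ℝ (Fin n)) : Prop :=
  ∃ U ∈ 𝓝 a, IsLNE (X ∩ U)

/-- The Peano tangent cone `C_a(X)`. -/
def peanoTangentCone {n : ℕ} (X : Set (EuclideanSpace ℝ (Fin n)))
    (a : EuclideanSpace ℝ (Fin n)) : Set (EuclideanSpace ℝ (Fin n)) :=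
  {v | ∃ (x : ℕ → EuclideanSpace ℝ (Fin n)) (t : ℕ → ℝ), (∀ k, x k ∈ X) ∧
    Tendsto x atTop (𝓝 a) ∧ (∀ k, 0 < t k) ∧ Tendsto (fun k => t k • (x k - a)) atTop (𝓝 v)}

/-- The closed half-line `ℝ₊ v`, for `v ≠ 0`. -/
def halfLine {n : ℕ} (v : EuclideanSpace ℝ (Fin n)) : Set (EuclideanSpace ℝ (Fin n)) :=
  {w | ∃ s : ℝ, 0 ≤ s ∧ w = s • v}

/-! Near `0⁺` a semialgebraic curve has coordinates that are continuous algebraic functions of the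
parameter, and such functions are tame: they have constant sign, are monotone, and comparable ones
have quotients with limits. All the geometry rests on this tameness.

Algebraicity is proved without quantifier elimination. Over a fixed `t` the graph has one point `a`.
The squares of the defining polynomials that vanish there add up to a nonnegative polynomial with an
isolated zero at `a`. Penalising it by `∑ xᵢ ^ (N + 1) / (N + 1)` gives critical points that satisfy
a system finite over `ℝ[t][s]` and tend to `a` as `s → ∞`. Eliminating all coordinates but one and
taking the leading coefficient in `s` leaves a nonzero polynomial relation between `t` and `a j`
(`exists_bivariate_vanishing_at_isolated_zeros`).

Since `‖γ‖` is also an algebraic germ, it is strictly increasing near `0`, so the arc can be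
parametrized by distance to the origin with monotone coordinates
(`IsSemialgebraicCurve.exists_isRadialCurve`). Then `σ r = r • v + o(r)` with `‖v‖ = 1`, and the
tangent cone is the half-line through `v`.

Distinct germs meet only at `0`. If the directions agree, `σ₁ r` and `σ₂ r` are `o(r)` apart, yet
any path joining them inside the union passes through `0` and has length at least `r`. If they
differ, points at distances `p`, `q` from `0` on different arcs are at least a multiple of `p + q`
apart, while monotone coordinates bound the length of each piece of arc by `n` times its chord. -/

/-! ### Elimination at isolated zeros of nonnegative polynomials -/

/-- Replacing `X i ^ N` by `-q i` strictly lowers the total degree, so by induction on the degree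
the finitely many monomials with all exponents below `N` span the quotient. -/
theorem MvPolynomial.finite_quotient_span_pow_add {B σ : Type*} [CommRing B] [Finite σ] (N : ℕ)
    (q : σ → MvPolynomial σ B) (hq : ∀ i, (q i).totalDegree < N) :
    Module.Finite B
      (MvPolynomial σ B ⧸ Ideal.span (range fun i => MvPolynomial.X i ^ N + q i)) := by
  classical
  set I := Ideal.span (range fun i => MvPolynomial.X i ^ N + q i) with hI
  let π : MvPolynomial σ B →ₐ[B] MvPolynomial σ B ⧸ I := Ideal.Quotient.mkₐ B I
  let S : Set (σ →₀ ℕ) := {α | ∀ i, α i < N}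
  have hS : S.Finite := by
    refine (Set.finite_Iic (Finsupp.equivFunOnFinite.symm fun _ : σ => N)).subset ?_
    intro α hα i
    simpa using (hα i).le
  let W : Submodule B (MvPolynomial σ B ⧸ I) :=
    Submodule.span B ((fun α => π (MvPolynomial.monomial α 1)) '' S)
  have key : ∀ d : ℕ, ∀ p : MvPolynomial σ B, p.totalDegree < d → π p ∈ W := by
    intro d
    induction d with
    | zero => intro p hp; omega
    | succ d ih =>
      intro p hp
      rw [p.as_sum, map_sum]
      refine Submodule.sum_mem _ fun α hα => ?_
      have hαd : α.degree ≤ d := by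
        have := MvPolynomial.le_totalDegree hα
        have h5 : α.degree = α.sum fun _ e => e := rfl
        omega
      have hmono : MvPolynomial.monomial α (p.coeff α)
          = p.coeff α • MvPolynomial.monomial α (1 : B) := by
        rw [MvPolynomial.smul_monomial, smul_eq_mul, mul_one]
      rw [hmono, map_smul]
      refine W.smul_mem _ ?_
      by_cases hαS : α ∈ S
      · exact Submodule.subset_span ⟨α, hαS, rfl⟩
      · obtain ⟨i, hi⟩ : ∃ i, N ≤ α i := by simpa [S] using hαS
        have hle : Finsupp.single i N ≤ α := by simpa using hi
        obtain ⟨β, rfl⟩ := exists_add_of_le hle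
        have hdeg : N + β.degree ≤ d := by simpa using hαd
        have hmem : (MvPolynomial.X i ^ N + q i) * MvPolynomial.monomial β 1 ∈ I :=
          I.mul_mem_right _ (Ideal.subset_span ⟨i, rfl⟩)
        have h0 : π ((MvPolynomial.X i ^ N + q i) * MvPolynomial.monomial β 1) = 0 :=
          Ideal.Quotient.eq_zero_iff_mem.mpr hmem
        have h1 : MvPolynomial.monomial (Finsupp.single i N + β) (1 : B)
            = MvPolynomial.X i ^ N * MvPolynomial.monomial β 1 := by
          rw [MvPolynomial.X_pow_eq_monomial, MvPolynomial.monomial_mul, one_mul]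
        rw [add_mul, map_add, ← h1] at h0
        rw [eq_neg_of_add_eq_zero_left h0]
        refine W.neg_mem (ih _ ?_)
        have h2 := MvPolynomial.totalDegree_mul (q i) (MvPolynomial.monomial β (1 : B))
        have h3 := MvPolynomial.totalDegree_monomial_le (R := B) β 1
        have h4 := hq i
        have h5 : β.degree = β.sum fun _ => id := rfl
        omega
  have hW : W = ⊤ := by
    rw [eq_top_iff]
    rintro x -
    obtain ⟨p, rfl⟩ := Ideal.Quotient.mk_surjective x
    exact key _ p (Nat.lt_succ_self _)
  exact ⟨hW ▸ Submodule.fg_span (hS.image _)⟩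

/-- A monic polynomial annihilates each coordinate of every solution of a system
`x_i ^ N + q_i(x) = 0` with `deg q_i < N`. -/
theorem MvPolynomial.exists_monic_of_totalDegree_lt {B σ : Type*} [CommRing B] [Finite σ] (N : ℕ)
    (q : σ → MvPolynomial σ B) (hq : ∀ i, (q i).totalDegree < N) (j : σ) :
    ∃ R : Polynomial B, R.Monic ∧ ∀ {A : Type} [CommRing A] (f : B →+* A) (x : σ → A),
      (∀ i, x i ^ N + MvPolynomial.eval₂ f x (q i) = 0) → R.eval₂ f (x j) = 0 := by
  set I := Ideal.span (range fun i => MvPolynomial.X i ^ N + q i) with hI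
  have := MvPolynomial.finite_quotient_span_pow_add N q hq
  -- Finiteness makes the class of `X j` integral; its monic equation then holds at every solution
  -- in every `B`-algebra.
  obtain ⟨R, hR, h0⟩ := IsIntegral.of_finite B (Ideal.Quotient.mk I (MvPolynomial.X j))
  refine ⟨R, hR, fun {A} _ f x hx => ?_⟩
  have hker : ∀ p ∈ I, MvPolynomial.eval₂Hom f x p = 0 := by
    intro p hp
    have : I ≤ RingHom.ker (MvPolynomial.eval₂Hom f x) := by
      rw [hI, Ideal.span_le]
      rintro _ ⟨i, rfl⟩
      simpa [RingHom.mem_ker] using hx i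
    exact this hp
  have h1 : Polynomial.aeval (MvPolynomial.X j) R ∈ I := by
    rw [← Ideal.Quotient.eq_zero_iff_mem, ← Ideal.Quotient.mkₐ_eq_mk B, ← Polynomial.aeval_algHom_apply]
    exact h0
  have h2 := hker _ h1
  rw [Polynomial.aeval_def, Polynomial.hom_eval₂] at h2
  have h3 : (MvPolynomial.eval₂Hom f x).comp (algebraMap B (MvPolynomial σ B)) = f := by
    ext b; simp [MvPolynomial.algebraMap_eq]
  simpa [h3] using h2

theorem MvPolynomial.hasDerivAt_eval₂_update {σ A : Type*} [DecidableEq σ] [CommRing A]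
    (f : A →+* ℝ) (p : MvPolynomial σ A) (x : σ → ℝ) (i : σ) (u : ℝ) :
    HasDerivAt (fun v => MvPolynomial.eval₂ f (Function.update x i v) p)
      (MvPolynomial.eval₂ f (Function.update x i u) (MvPolynomial.pderiv i p)) u := by
  induction p using MvPolynomial.induction_on with
  | C a => simpa using hasDerivAt_const u (f a)
  | add p q hp hq => simpa [MvPolynomial.eval₂_add] using hp.fun_add hq
  | mul_X p j hp =>
    have hX : HasDerivAt (fun v => Function.update x i v j) (if j = i then 1 else 0) u := by
      by_cases h : j = i
      · subst h; simpa using hasDerivAt_id' u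
      · simpa [h] using hasDerivAt_const u (x j)
    have h1 := hp.fun_mul hX
    simp only [MvPolynomial.eval₂_mul, MvPolynomial.eval₂_X, MvPolynomial.pderiv_mul,
      MvPolynomial.pderiv_X, MvPolynomial.eval₂_add] at h1 ⊢
    refine h1.congr_deriv ?_
    by_cases h : j = i
    · subst h; simp
    · simp [h]

theorem MvPolynomial.continuous_eval₂_real {σ A : Type*} [CommRing A] (f : A →+* ℝ)
    (p : MvPolynomial σ A) : Continuous fun x : σ → ℝ => MvPolynomial.eval₂ f x p := by
  induction p using MvPolynomial.induction_on with
  | C a => simpa using continuous_const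
  | add p q hp hq => simpa [MvPolynomial.eval₂_add] using hp.fun_add hq
  | mul_X p j hp => simpa [MvPolynomial.eval₂_mul] using hp.fun_mul (continuous_apply j)

/-- If `F ≥ 0` has an isolated zero at `a`, then `s F + ∑ xᵢ ^ (N + 1) / (N + 1)` has a critical
point near `a` for all large `s`. -/
theorem exists_critical_point_near {n N : ℕ} {A : Type*} [CommRing A] (f : A →+* ℝ)
    (Q : MvPolynomial (Fin n) A) (a : Fin n → ℝ)
    (hpos : ∀ x, 0 ≤ MvPolynomial.eval₂ f x Q) (h0 : MvPolynomial.eval₂ f a Q = 0)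
    (hiso : ∀ᶠ x in 𝓝[≠] a, MvPolynomial.eval₂ f x Q ≠ 0) {η : ℝ} (hη : 0 < η) (s₀ : ℝ) :
    ∃ s, s₀ < s ∧ ∃ x, dist x a < η ∧
      ∀ i, x i ^ N + s * MvPolynomial.eval₂ f x (MvPolynomial.pderiv i Q) = 0 := by
  set F : (Fin n → ℝ) → ℝ := fun x => MvPolynomial.eval₂ f x Q with hF
  have hFc : Continuous F := MvPolynomial.continuous_eval₂_real f Q
  set H : (Fin n → ℝ) → ℝ := fun x => ∑ i, x i ^ (N + 1) / (N + 1) with hH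
  have hHc : Continuous H := by fun_prop
  obtain ⟨δ, hδ, hδF⟩ := Metric.eventually_nhds_iff.1 (eventually_nhdsWithin_iff.1 hiso)
  set r := min η δ / 2 with hr
  have hrpos : 0 < r := by positivity
  have hrη : r < η := by have := min_le_left η δ; have := lt_min hη hδ; linarith
  have hrδ : r < δ := by have := min_le_right η δ; have := lt_min hη hδ; linarith
  obtain ⟨m, hm, hmF⟩ : ∃ m > 0, ∀ x ∈ Metric.sphere a r, m ≤ F x := by
    rcases (Metric.sphere a r).eq_empty_or_nonempty with he | hne
    · exact ⟨1, one_pos, by simp [he]⟩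
    · obtain ⟨z, hz, hzmin⟩ := (isCompact_sphere a r).exists_isMinOn hne hFc.continuousOn
      have hz' : dist z a = r := hz
      have hza : z ≠ a := by rintro rfl; simp at hz'; linarith
      exact ⟨F z, lt_of_le_of_ne (hpos z) (Ne.symm (hδF (by rw [hz']; exact hrδ) hza)),
        fun x hx => hzmin hx⟩
  obtain ⟨K, hK⟩ := (isCompact_closedBall a r).exists_bound_of_continuousOn hHc.continuousOn
  have hHa := hK a (Metric.mem_closedBall_self hrpos.le)
  have hK0 : 0 ≤ K := (norm_nonneg _).trans hHa
  -- With `s * m > 2 * K`, the penalised function exceeds `K` on the sphere and is at most `K` at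
  -- `a`, so its minimum over the ball is interior.
  set s := max (s₀ + 1) (2 * K / m + 1) with hs
  have hs0 : s₀ < s := lt_of_lt_of_le (by linarith) (le_max_left _ _)
  have hsm : 2 * K < s * m := by
    have : 2 * K / m < s := lt_of_lt_of_le (by linarith) (le_max_right _ _)
    rwa [div_lt_iff₀ hm] at this
  set g : (Fin n → ℝ) → ℝ := fun x => s * F x + H x with hg
  have hgc : Continuous g := by fun_prop
  obtain ⟨x, hx, hxmin⟩ := (isCompact_closedBall a r).exists_isMinOn
    ⟨a, Metric.mem_closedBall_self hrpos.le⟩ hgc.continuousOn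
  have hxball : dist x a < r := by
    refine lt_of_le_of_ne hx fun hxs => ?_
    have h1 : g x ≤ g a := hxmin (Metric.mem_closedBall_self hrpos.le)
    have h2 : m ≤ F x := hmF x hxs
    have h3 := abs_le.1 (hK x hx)
    have h4 := abs_le.1 hHa
    have h5 : s * m ≤ s * F x := by
      refine mul_le_mul_of_nonneg_left h2 ?_
      have : 0 ≤ 2 * K / m := by positivity
      exact le_trans (by linarith) (le_max_right _ _)
    simp only [hg, hF] at h1 h5
    rw [h0] at h1
    simp only [hF] at h2
    linarith [h3.1, h4.2]
  refine ⟨s, hs0, x, hxball.trans hrη, fun i => ?_⟩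
  have hloc : IsLocalMin g x := by
    filter_upwards [Metric.ball_mem_nhds x (sub_pos.2 hxball)] with y hy
    refine hxmin (Metric.mem_closedBall.2 ?_)
    have := dist_triangle y x a
    have : dist y x < r - dist x a := hy
    linarith
  have hloc1 : IsLocalMin (fun u => g (Function.update x i u)) (x i) := by
    have hcont : Tendsto (fun u => Function.update x i u) (𝓝 (x i)) (𝓝 x) := by
      have : Continuous fun u : ℝ => Function.update x i u := continuous_const.update i continuous_id
      simpa using this.tendsto (x i)
    have := hcont.eventually hloc
    simpa [IsLocalMin, IsMinFilter] using this
  have hd1 := MvPolynomial.hasDerivAt_eval₂_update f Q x i (x i)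
  have hd2 : HasDerivAt (fun u => H (Function.update x i u)) (x i ^ N) (x i) := by
    have : ∀ k ∈ Finset.univ, HasDerivAt (fun u => Function.update x i u k ^ (N + 1) / ((N : ℝ) + 1))
        (if k = i then x i ^ N else 0) (x i) := by
      intro k _
      by_cases h : k = i
      · subst h
        have := (hasDerivAt_pow (N + 1) (x k)).div_const ((N : ℝ) + 1)
        have hN : (N : ℝ) + 1 ≠ 0 := by positivity
        simpa [mul_comm, hN] using this
      · simpa [h] using hasDerivAt_const (x i) (x k ^ (N + 1) / ((N : ℝ) + 1))
    simpa [hH] using HasDerivAt.fun_sum this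
  have hd := (hd1.const_mul s).add hd2
  have := hloc1.hasDerivAt_eq_zero hd
  simp only [Function.update_eq_self] at this
  linarith

open Polynomial in
-- Divide the equation by `s ^ D`: every term except the one of degree `D` tends to `0`. The
-- coefficient of degree `D` is allowed to be zero.
theorem Polynomial.eval_coeff_eq_zero_of_tendsto (G : ℝ[X][X]) (D : ℕ) (hD : G.natDegree ≤ D)
    (s y : ℕ → ℝ) (b : ℝ) (hs : Tendsto s atTop atTop) (hy : Tendsto y atTop (𝓝 b))
    (h : ∀ k, G.evalEval (y k) (s k) = 0) : (G.coeff D).eval b = 0 := by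
  have hlim : Tendsto (fun k => ∑ i ∈ Finset.range (D + 1),
      (G.coeff i).eval (y k) * (s k)⁻¹ ^ (D - i)) atTop
      (𝓝 (∑ i ∈ Finset.range (D + 1), (G.coeff i).eval b * (0 : ℝ) ^ (D - i))) := by
    refine tendsto_finsetSum _ fun i _ => ?_
    exact (((G.coeff i).continuous.tendsto b).comp hy).mul
      ((tendsto_inv_atTop_zero.comp hs).pow (D - i))
  have hsum : ∑ i ∈ Finset.range (D + 1), (G.coeff i).eval b * (0 : ℝ) ^ (D - i)
      = (G.coeff D).eval b := by
    rw [Finset.sum_eq_single D]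
    · simp
    · intro i hi hiD
      have : D - i ≠ 0 := by simp only [Finset.mem_range] at hi; omega
      simp [this]
    · simp
  rw [hsum] at hlim
  refine tendsto_nhds_unique hlim (tendsto_const_nhds.congr' ?_)
  filter_upwards [hs.eventually_gt_atTop 0] with k hk
  have h1 := h k
  rw [evalEval, eval_eq_sum_range' (Nat.lt_succ_of_le hD), eval_finsetSum] at h1
  have h2 : ∀ i ∈ Finset.range (D + 1), (G.coeff i).eval (y k) * (s k)⁻¹ ^ (D - i)
      = (s k)⁻¹ ^ D * ((G.coeff i * C (s k) ^ i).eval (y k)) := by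
    intro i hi
    have : i ≤ D := by simp only [Finset.mem_range] at hi; omega
    simp only [eval_mul, eval_pow, eval_C]
    have h3 : (s k)⁻¹ ^ D = (s k)⁻¹ ^ (D - i) * (s k)⁻¹ ^ i := by
      rw [← pow_add, Nat.sub_add_cancel this]
    have h4 : (s k)⁻¹ ^ i * s k ^ i = 1 := by
      rw [← mul_pow, inv_mul_cancel₀ hk.ne', one_pow]
    rw [h3]
    linear_combination (-(G.coeff i).eval (y k) * (s k)⁻¹ ^ (D - i)) * h4
  rw [Finset.sum_congr rfl h2, ← Finset.mul_sum, h1, mul_zero]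

open Polynomial in
theorem exists_bivariate_vanishing_at_isolated_zeros {n : ℕ} (Q : MvPolynomial (Fin n) ℝ[X])
    (j : Fin n) :
    ∃ P : ℝ[X][X], P ≠ 0 ∧ ∀ (t : ℝ) (a : Fin n → ℝ),
      (∀ x, 0 ≤ MvPolynomial.eval₂ (evalRingHom t) x Q) →
      MvPolynomial.eval₂ (evalRingHom t) a Q = 0 →
      (∀ᶠ x in 𝓝[≠] a, MvPolynomial.eval₂ (evalRingHom t) x Q ≠ 0) →
      P.evalEval t (a j) = 0 := by
  set N := (Finset.univ.sup fun i => (MvPolynomial.pderiv i Q).totalDegree) + 1 with hN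
  let q : Fin n → MvPolynomial (Fin n) ℝ[X][X] := fun i =>
    MvPolynomial.C X * MvPolynomial.map C (MvPolynomial.pderiv i Q)
  have hq : ∀ i, (q i).totalDegree < N := by
    intro i
    have h1 := MvPolynomial.totalDegree_mul (MvPolynomial.C (X : ℝ[X][X]))
      (MvPolynomial.map C (MvPolynomial.pderiv i Q))
    have h2 : (MvPolynomial.map (C : ℝ[X] →+* ℝ[X][X]) (MvPolynomial.pderiv i Q)).totalDegree
      ≤ (MvPolynomial.pderiv i Q).totalDegree := Finset.sup_mono (MvPolynomial.support_map_subset _ _)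
    have h3 := Finset.le_sup (f := fun i => (MvPolynomial.pderiv i Q).totalDegree)
      (Finset.mem_univ i)
    simp only [MvPolynomial.totalDegree_C, zero_add] at h1
    simp only [q]
    omega
  obtain ⟨R, hR, hRx⟩ := MvPolynomial.exists_monic_of_totalDegree_lt N q hq j
  -- `R` lies in `ℝ[t][s][y]`; the swap makes `s` the outermost variable, so that the leading
  -- coefficient is a polynomial in `t` and `y`.
  have hR0 : Bivariate.swap R ≠ 0 := by
    simpa using hR.ne_zero
  refine ⟨(Bivariate.swap R).leadingCoeff, by simpa using hR0, fun t a hpos h0 hiso => ?_⟩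
  have hex : ∀ k : ℕ, ∃ s, (k : ℝ) < s ∧ ∃ x, dist x a < 1 / ((k : ℝ) + 1) ∧
      ∀ i, x i ^ N + s * MvPolynomial.eval₂ (evalRingHom t) x (MvPolynomial.pderiv i Q) = 0 :=
    fun k => exists_critical_point_near _ Q a hpos h0 hiso (by positivity) k
  choose s hs x hxa hx using hex
  have hs' : Tendsto s atTop atTop :=
    tendsto_atTop_mono (fun k => (hs k).le) tendsto_natCast_atTop_atTop
  have hx' : Tendsto x atTop (𝓝 a) := by
    rw [tendsto_iff_dist_tendsto_zero]
    exact squeeze_zero (fun _ => dist_nonneg) (fun k => (hxa k).le)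
      tendsto_one_div_add_atTop_nhds_zero_nat
  set G : ℝ[X][X] := (Bivariate.swap R).map (mapRingHom (evalRingHom t)) with hG
  have hGk : ∀ k, G.evalEval (x k j) (s k) = 0 := by
    intro k
    have h1 := hRx (eval₂RingHom (evalRingHom t) (s k)) (x k) (fun i => by
      have := hx k i
      simp only [q, MvPolynomial.eval₂_mul, MvPolynomial.eval₂_C, MvPolynomial.eval₂_map]
      have hc : (eval₂RingHom (evalRingHom t) (s k)).comp C = evalRingHom t := by
        ext <;> simp
      rw [hc]
      simpa using this)
    have hhom : (evalEvalRingHom (x k j) (s k)).comp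
        ((mapRingHom (mapRingHom (evalRingHom t))).comp
          (Bivariate.swap (R := ℝ[X])).toAlgHom.toRingHom)
        = eval₂RingHom (eval₂RingHom (evalRingHom t) (s k)) (x k j) := by
      ext <;> simp [Bivariate.swap_apply]
    rw [hG, ← h1]
    exact RingHom.congr_fun hhom R
  -- The degree in `s` may drop when `t` is specialised, hence the degree of the unspecialised
  -- polynomial is used.
  have := eval_coeff_eq_zero_of_tendsto G (Bivariate.swap R).natDegree natDegree_map_le s _ (a j)
    hs' ((continuous_apply j).tendsto a |>.comp hx') hGk
  rw [hG, coeff_map, coe_mapRingHom] at this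
  rw [← this, ← map_evalRingHom_eval]
  rfl

/-! ### Coordinates of semialgebraic curves are algebraic -/

theorem IsSemialgebraic.exists_finset {σ : Type} {S : Set (σ → ℝ)} (hS : IsSemialgebraic S) :
    ∃ F : Finset (MvPolynomial σ ℝ), ∀ x y : σ → ℝ,
      (∀ p ∈ F, (0 < MvPolynomial.eval x p ↔ 0 < MvPolynomial.eval y p)) → (x ∈ S ↔ y ∈ S) := by
  classical
  induction hS with
  | pos p => exact ⟨{p}, fun x y h => h p (by simp)⟩
  | compl _ ih =>
    obtain ⟨F, hF⟩ := ih
    exact ⟨F, fun x y h => not_congr (hF x y h)⟩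
  | union _ _ ih₁ ih₂ =>
    obtain ⟨F, hF⟩ := ih₁
    obtain ⟨G, hG⟩ := ih₂
    exact ⟨F ∪ G, fun x y h => or_congr
      (hF x y fun p hp => h p (Finset.mem_union_left _ hp))
      (hG x y fun p hp => h p (Finset.mem_union_right _ hp))⟩

open Polynomial in
/-- A polynomial in `(t, x)` regarded as a polynomial in `x` with coefficients in `ℝ[t]`. -/
noncomputable def MvPolynomial.splitFirst {n : ℕ} (p : MvPolynomial (Fin (n + 1)) ℝ) :
    MvPolynomial (Fin n) ℝ[X] :=
  MvPolynomial.aeval (Fin.cons (MvPolynomial.C Polynomial.X) MvPolynomial.X) p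

theorem MvPolynomial.eval₂_splitFirst {n : ℕ} (p : MvPolynomial (Fin (n + 1)) ℝ) (t : ℝ)
    (x : Fin n → ℝ) :
    MvPolynomial.eval₂ (Polynomial.evalRingHom t) x p.splitFirst
      = MvPolynomial.eval (Fin.cons t x) p := by
  have : (MvPolynomial.eval₂Hom (Polynomial.evalRingHom t) x).comp
      (MvPolynomial.aeval (R := ℝ) (S₁ := MvPolynomial (Fin n) (Polynomial ℝ))
        (Fin.cons (MvPolynomial.C Polynomial.X) MvPolynomial.X)).toRingHom
      = MvPolynomial.eval (Fin.cons t x) := by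
    refine MvPolynomial.ringHom_ext (fun r => ?_) (fun i => ?_)
    · simp [MvPolynomial.algebraMap_apply]
    · refine Fin.cases ?_ (fun i => ?_) i <;> simp
  exact RingHom.congr_fun this p

open Polynomial in
theorem IsSemialgebraic.exists_bivariate_vanishing_on_graph {n : ℕ}
    {γ : ℝ → EuclideanSpace ℝ (Fin n)} (hγ : IsSemialgebraic (curveGraph γ)) (j : Fin n) :
    ∃ P : ℝ[X][X], P ≠ 0 ∧ ∀ t ∈ Ico (0 : ℝ) 1, P.evalEval t (γ t j) = 0 := by
  classical
  obtain ⟨F, hF⟩ := hγ.exists_finset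
  choose P hP0 hP using fun I : Finset (MvPolynomial (Fin (n + 1)) ℝ) =>
    exists_bivariate_vanishing_at_isolated_zeros (∑ p ∈ I, p ^ 2).splitFirst j
  -- The set of polynomials vanishing at the graph point depends on `t`, so the product runs over
  -- all possible sets.
  refine ⟨∏ I ∈ F.powerset, P I, Finset.prod_ne_zero_iff.2 fun I _ => hP0 I, fun t ht => ?_⟩
  set a : Fin n → ℝ := fun i => γ t i with ha
  have haG : (Fin.cons t a : Fin (n + 1) → ℝ) ∈ curveGraph γ := ⟨by simpa using ht, by simp [ha]⟩
  have huniq : ∀ x : Fin n → ℝ, (Fin.cons t x : Fin (n + 1) → ℝ) ∈ curveGraph γ → x = a := by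
    rintro x ⟨-, hx⟩
    ext i
    simpa [ha] using hx i
  set I := F.filter fun p => MvPolynomial.eval (Fin.cons t a) p = 0 with hI
  rw [evalEval_prod]
  refine Finset.prod_eq_zero (Finset.mem_powerset.2 (Finset.filter_subset _ F) : I ∈ _) ?_
  have hval : ∀ x : Fin n → ℝ, MvPolynomial.eval₂ (evalRingHom t) x (∑ p ∈ I, p ^ 2).splitFirst
      = ∑ p ∈ I, (MvPolynomial.eval (Fin.cons t x : Fin (n + 1) → ℝ) p) ^ 2 := by
    intro x
    rw [MvPolynomial.eval₂_splitFirst, map_sum]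
    simp
  refine hP I t a (fun x => ?_) ?_ ?_
  · rw [hval]; positivity
  · rw [hval]
    refine Finset.sum_eq_zero fun p hp => ?_
    rw [(Finset.mem_filter.1 hp).2]; simp
  · have hcont : ∀ p : MvPolynomial (Fin (n + 1)) ℝ, Continuous fun x : Fin n → ℝ =>
        MvPolynomial.eval (Fin.cons t x : Fin (n + 1) → ℝ) p := fun p => by
      simpa only [← MvPolynomial.eval₂_splitFirst] using
        MvPolynomial.continuous_eval₂_real (evalRingHom t) p.splitFirst
    -- Polynomials outside `I` keep their sign near `a`. A nearby common zero of `I` thus has the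
    -- same sign pattern as `a`, lies on the graph, and equals `a`.
    have hsign : ∀ᶠ x in 𝓝 a, ∀ p ∈ F, p ∉ I →
        (0 < MvPolynomial.eval (Fin.cons t x : Fin (n + 1) → ℝ) p ↔
          0 < MvPolynomial.eval (Fin.cons t a : Fin (n + 1) → ℝ) p) := by
      refine (Finset.eventually_all F).2 fun p hp => ?_
      by_cases hpI : p ∈ I
      · exact Eventually.of_forall fun _ h => absurd hpI h
      have hne : MvPolynomial.eval (Fin.cons t a : Fin (n + 1) → ℝ) p ≠ 0 := fun h =>
        hpI (Finset.mem_filter.2 ⟨hp, h⟩)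
      rcases hne.lt_or_gt with h | h
      · filter_upwards [(hcont p).continuousAt.eventually_lt_const h] with x hx _
        exact ⟨fun h' => absurd h' hx.not_gt, fun h' => absurd h' h.not_gt⟩
      · filter_upwards [(hcont p).continuousAt.eventually_const_lt h] with x hx _
        exact ⟨fun _ => h, fun _ => hx⟩
    rw [eventually_nhdsWithin_iff]
    filter_upwards [hsign] with x hx hxa h0
    rw [hval, Finset.sum_eq_zero_iff_of_nonneg (fun p _ => sq_nonneg _)] at h0
    refine hxa (huniq x ((hF _ _ fun p hp => ?_).2 haG))
    by_cases hpI : p ∈ I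
    · rw [pow_eq_zero_iff two_ne_zero |>.1 (h0 p hpI), (Finset.mem_filter.1 hpI).2]
    · exact hx p hp hpI

/-! ### Germs at `0⁺` of continuous algebraic functions -/

theorem eventually_nhdsGT_zero_iff {p : ℝ → Prop} :
    (∀ᶠ t in 𝓝[>] (0 : ℝ), p t) ↔ ∃ δ > 0, ∀ t ∈ Ioo 0 δ, p t :=
  mem_nhdsGT_iff_exists_Ioo_subset

theorem IsPreconnected.pos_or_neg {f : ℝ → ℝ} {s : Set ℝ} (hs : IsPreconnected s)
    (hf : ContinuousOn f s) (h0 : ∀ x ∈ s, f x ≠ 0) :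
    (∀ x ∈ s, 0 < f x) ∨ ∀ x ∈ s, f x < 0 := by
  by_contra! h
  obtain ⟨⟨x, hx, hfx⟩, y, hy, hfy⟩ := h
  obtain ⟨z, hz, hz0⟩ := (hs.image f hf).ordConnected.out (mem_image_of_mem f hx)
    (mem_image_of_mem f hy) ⟨hfx, hfy⟩
  exact h0 z hz hz0

namespace Polynomial

theorem eventually_eval_ne_zero {a : ℝ[X]} (ha : a ≠ 0) :
    ∀ᶠ t in 𝓝[>] (0 : ℝ), a.eval t ≠ 0 := by
  have hfin : ({t | a.eval t = 0} \ {0}).Finite :=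
    ((a.roots.toFinset.finite_toSet).subset fun t ht => by simpa [ha] using ht).subset sdiff_subset
  have hmem : ({t | a.eval t = 0} \ {0})ᶜ ∈ 𝓝 (0 : ℝ) :=
    hfin.isClosed.isOpen_compl.mem_nhds (by simp)
  filter_upwards [mem_nhdsWithin_of_mem_nhds hmem, self_mem_nhdsWithin] with t ht ht0 h0
  exact ht ⟨h0, (ht0 : 0 < t).ne'⟩

theorem continuous_evalEval (P : ℝ[X][X]) : Continuous fun z : ℝ × ℝ => P.evalEval z.1 z.2 := by
  induction P using Polynomial.induction_on' with
  | add p q hp hq => simpa [evalEval_add] using hp.fun_add hq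
  | monomial n a =>
    have : Continuous fun z : ℝ × ℝ => a.eval z.1 * z.2 ^ n :=
      (a.continuous.comp continuous_fst).mul (continuous_snd.pow n)
    simpa [evalEval, eval_monomial] using this

theorem evalEval_swap (P : ℝ[X][X]) (x y : ℝ) :
    (Bivariate.swap P).evalEval x y = P.evalEval y x := by
  have := Bivariate.aevalAeval_swap x y P
  rwa [coe_aevalAeval_eq_evalEval, coe_aevalAeval_eq_evalEval] at this

/-- Evaluation of real polynomials near `0⁺`. -/
noncomputable def germRingHom : ℝ[X] →+* Germ (𝓝[>] (0 : ℝ)) ℝ :=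
  (Germ.coeRingHom _).comp (RingHom.pi fun t : ℝ => evalRingHom t)

noncomputable instance germAlgebra : Algebra ℝ[X] (Germ (𝓝[>] (0 : ℝ)) ℝ) :=
  germRingHom.toAlgebra

theorem algebraMap_germ (p : ℝ[X]) :
    algebraMap ℝ[X] (Germ (𝓝[>] (0 : ℝ)) ℝ) p = ((fun t => p.eval t : ℝ → ℝ) : Germ _ ℝ) := rfl

theorem aeval_germ (P : ℝ[X][X]) (f : ℝ → ℝ) :
    aeval (f : Germ (𝓝[>] (0 : ℝ)) ℝ) P
      = ((fun t => P.evalEval t (f t) : ℝ → ℝ) : Germ (𝓝[>] (0 : ℝ)) ℝ) := by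
  induction P using Polynomial.induction_on' with
  | add p q hp hq =>
    rw [map_add, hp, hq, ← Germ.coe_add]
    congr 1
    ext t
    simp [evalEval_add]
  | monomial n a =>
    rw [aeval_monomial, algebraMap_germ, ← Germ.coe_pow, ← Germ.coe_mul]
    congr 1
    ext t
    simp [evalEval, eval_monomial]

end Polynomial

open Polynomial

/-- The germ of `f` at `0⁺` is continuous and algebraic over the real polynomials. -/
structure IsAlgebraicGerm (f : ℝ → ℝ) : Prop where
  isAlgebraic : IsAlgebraic ℝ[X] (f : Germ (𝓝[>] (0 : ℝ)) ℝ)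
  continuousAt : ∀ᶠ t in 𝓝[>] (0 : ℝ), ContinuousAt f t

theorem isAlgebraic_germ_iff {f : ℝ → ℝ} :
    IsAlgebraic ℝ[X] (f : Germ (𝓝[>] (0 : ℝ)) ℝ) ↔
      ∃ P : ℝ[X][X], P ≠ 0 ∧ ∀ᶠ t in 𝓝[>] (0 : ℝ), P.evalEval t (f t) = 0 := by
  refine exists_congr fun P => and_congr_right fun _ => ?_
  rw [aeval_germ]
  exact Germ.coe_eq

namespace IsAlgebraicGerm

variable {f g : ℝ → ℝ}

theorem add (hf : IsAlgebraicGerm f) (hg : IsAlgebraicGerm g) :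
    IsAlgebraicGerm fun t => f t + g t :=
  ⟨hf.1.add hg.1, by filter_upwards [hf.2, hg.2] with t h₁ h₂ using h₁.add h₂⟩

theorem mul (hf : IsAlgebraicGerm f) (hg : IsAlgebraicGerm g) :
    IsAlgebraicGerm fun t => f t * g t :=
  ⟨hf.1.mul hg.1, by filter_upwards [hf.2, hg.2] with t h₁ h₂ using h₁.mul h₂⟩

theorem sub (hf : IsAlgebraicGerm f) (hg : IsAlgebraicGerm g) :
    IsAlgebraicGerm fun t => f t - g t :=
  ⟨hf.1.sub hg.1, by filter_upwards [hf.2, hg.2] with t h₁ h₂ using h₁.sub h₂⟩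

theorem polynomial (p : ℝ[X]) : IsAlgebraicGerm fun t => p.eval t :=
  ⟨isAlgebraic_algebraMap p, Eventually.of_forall fun _ => p.continuousAt⟩

theorem const (c : ℝ) : IsAlgebraicGerm fun _ => c := by
  simpa using polynomial (C c)

theorem sum {ι : Type*} (s : Finset ι) (f : ι → ℝ → ℝ) (hf : ∀ i ∈ s, IsAlgebraicGerm (f i)) :
    IsAlgebraicGerm fun t => ∑ i ∈ s, f i t := by
  classical
  induction s using Finset.induction_on with
  | empty => simpa using const 0
  | insert i s hi ih =>
    simp only [Finset.sum_insert hi]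
    exact (hf i (by simp)).add (ih fun j hj => hf j (by simp [hj]))

theorem evalEval (hf : IsAlgebraicGerm f) (P : ℝ[X][X]) :
    IsAlgebraicGerm fun t => P.evalEval t (f t) := by
  induction P using Polynomial.induction_on' with
  | add p q hp hq => simpa [evalEval_add] using hp.add hq
  | monomial n a =>
    have : ∀ n : ℕ, IsAlgebraicGerm fun t => a.eval t * f t ^ n := by
      intro n
      induction n with
      | zero => simpa using polynomial a
      | succ n ih => simpa [pow_succ, mul_assoc] using ih.mul hf
    simpa [Polynomial.evalEval, eval_monomial] using this n

theorem sqrt (hf : IsAlgebraicGerm f) (h0 : ∀ t, 0 ≤ f t) :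
    IsAlgebraicGerm fun t => √(f t) := by
  refine ⟨IsAlgebraic.of_pow two_pos ?_, ?_⟩
  · have : ((fun t => √(f t) : ℝ → ℝ) : Germ (𝓝[>] (0 : ℝ)) ℝ) ^ 2 = (f : Germ _ ℝ) := by
      rw [← Germ.coe_pow]
      congr 1
      ext t
      simp [Real.sq_sqrt (h0 t)]
    rw [this]
    exact hf.1
  · filter_upwards [hf.2] with t ht using ht.sqrt

/-- The germ at `0⁺` of a continuous algebraic function either vanishes or is nowhere zero. -/
theorem eventually_eq_zero_or_ne_zero (hf : IsAlgebraicGerm f) :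
    (∀ᶠ t in 𝓝[>] (0 : ℝ), f t = 0) ∨ ∀ᶠ t in 𝓝[>] (0 : ℝ), f t ≠ 0 := by
  obtain ⟨P, hP, hPf⟩ := isAlgebraic_germ_iff.1 hf.1
  -- Factor `P = Y ^ m * Q` with `Q(t, 0)` not identically zero. For small `t` exactly one of `f t`
  -- and `Q(t, f t)` vanishes, so the difference of their squares is continuous and never zero; its
  -- constant sign tells which one vanishes throughout.
  obtain ⟨Q, hPQ, hQ⟩ := exists_eq_pow_rootMultiplicity_mul_and_not_dvd P hP 0
  simp only [map_zero, sub_zero] at hPQ hQ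
  rw [X_dvd_iff] at hQ
  obtain ⟨δ, hδ, h⟩ := eventually_nhdsGT_zero_iff.1
    (hPf.and ((eventually_eval_ne_zero hQ).and hf.2))
  have hor : ∀ t ∈ Ioo 0 δ, f t = 0 ∨ Q.evalEval t (f t) = 0 := by
    intro t ht
    have := (h t ht).1
    rw [hPQ, evalEval_mul, evalEval_pow, evalEval_X, mul_eq_zero] at this
    exact this.imp_left fun h => eq_zero_of_pow_eq_zero h
  have hand : ∀ t ∈ Ioo 0 δ, f t = 0 → Q.evalEval t (f t) ≠ 0 := by
    intro t ht h0
    rw [h0, Polynomial.evalEval, C_0, ← coeff_zero_eq_eval_zero]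
    exact (h t ht).2.1
  have hcont : ContinuousOn (fun t => f t ^ 2 - Q.evalEval t (f t) ^ 2) (Ioo 0 δ) := by
    intro t ht
    have hft := (h t ht).2.2
    have hQt : ContinuousAt (fun t => Q.evalEval t (f t)) t :=
      (continuous_evalEval Q).continuousAt.comp (continuousAt_id.prodMk hft)
    exact ((hft.pow 2).sub (hQt.pow 2)).continuousWithinAt
  have hne : ∀ t ∈ Ioo 0 δ, f t ^ 2 - Q.evalEval t (f t) ^ 2 ≠ 0 := by
    intro t ht h0
    rcases hor t ht with h1 | h1
    · exact hand t ht h1 (by simpa [h1] using h0)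
    · have h2 : f t = 0 := by simpa [h1] using h0
      exact hand t ht h2 h1
  rcases isPreconnected_Ioo.pos_or_neg hcont hne with hs | hs
  · right
    refine eventually_nhdsGT_zero_iff.2 ⟨δ, hδ, fun t ht h0 => ?_⟩
    have := hs t ht
    rw [h0] at this
    nlinarith [sq_nonneg (Q.evalEval t 0)]
  · left
    refine eventually_nhdsGT_zero_iff.2 ⟨δ, hδ, fun t ht => ?_⟩
    refine (hor t ht).resolve_right fun h0 => ?_
    have := hs t ht
    rw [h0] at this
    nlinarith [sq_nonneg (f t)]

theorem eventually_sign (hf : IsAlgebraicGerm f) :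
    (∀ᶠ t in 𝓝[>] (0 : ℝ), f t = 0) ∨ (∀ᶠ t in 𝓝[>] (0 : ℝ), 0 < f t) ∨
      ∀ᶠ t in 𝓝[>] (0 : ℝ), f t < 0 := by
  refine hf.eventually_eq_zero_or_ne_zero.imp_right fun h => ?_
  obtain ⟨δ, hδ, h⟩ := eventually_nhdsGT_zero_iff.1 (h.and hf.2)
  rcases isPreconnected_Ioo.pos_or_neg
    (fun t ht => (h t ht).2.continuousWithinAt) (fun t ht => (h t ht).1) with h' | h'
  · exact .inl (eventually_nhdsGT_zero_iff.2 ⟨δ, hδ, h'⟩)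
  · exact .inr (eventually_nhdsGT_zero_iff.2 ⟨δ, hδ, h'⟩)

end IsAlgebraicGerm

/-- The ring of continuous algebraic germs at `0⁺`. -/
noncomputable def algebraicGerms : Subalgebra ℝ[X] (Germ (𝓝[>] (0 : ℝ)) ℝ) where
  carrier := {φ | ∃ f : ℝ → ℝ, IsAlgebraicGerm f ∧ φ = f}
  mul_mem' := by
    rintro _ _ ⟨f, hf, rfl⟩ ⟨g, hg, rfl⟩
    exact ⟨_, hf.mul hg, rfl⟩
  add_mem' := by
    rintro _ _ ⟨f, hf, rfl⟩ ⟨g, hg, rfl⟩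
    exact ⟨_, hf.add hg, rfl⟩
  algebraMap_mem' p := ⟨_, .polynomial p, rfl⟩

/-- Follows from the dichotomy of vanishing or nowhere zero. The full germ ring has zero divisors;
transitivity of algebraicity, used in `IsAlgebraicGerm.comp`, goes through this domain. -/
instance : NoZeroDivisors algebraicGerms where
  eq_zero_or_eq_zero_of_mul_eq_zero := by
    rintro ⟨_, f, hf, rfl⟩ ⟨_, g, hg, rfl⟩ h
    have h : ((fun t => f t * g t : ℝ → ℝ) : Germ (𝓝[>] (0 : ℝ)) ℝ) = ((0 : ℝ → ℝ) : Germ _ ℝ) :=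
      congrArg Subtype.val h
    have hz : ∀ {u : ℝ → ℝ} (hu : IsAlgebraicGerm u), (∀ᶠ t in 𝓝[>] (0 : ℝ), u t = 0) →
        (⟨u, u, hu, rfl⟩ : algebraicGerms) = 0 := fun hu h0 =>
      Subtype.ext (Germ.coe_eq.2 h0)
    rcases hf.eventually_eq_zero_or_ne_zero with h1 | h1
    · exact .inl (hz hf h1)
    · refine .inr (hz hg ?_)
      filter_upwards [h1, Germ.coe_eq.1 h] with t h2 h3
      exact (mul_eq_zero.1 h3).resolve_left h2

instance : Algebra.IsAlgebraic ℝ[X] algebraicGerms where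
  isAlgebraic := by
    rintro ⟨_, f, hf, rfl⟩
    exact (isAlgebraic_algHom_iff algebraicGerms.val Subtype.val_injective).1 hf.1

/-! ### Derivatives, monotonicity, composition and limits of algebraic germs -/

namespace Polynomial

theorem hasDerivAt_evalEval_snd (P : ℝ[X][X]) (t y : ℝ) :
    HasDerivAt (fun y => P.evalEval t y) ((derivative P).evalEval t y) y := by
  simp only [← map_evalRingHom_eval]
  rw [← derivative_map]
  exact Polynomial.hasDerivAt _ _

/-- The partial derivative of a polynomial in two variables with respect to the inner variable. -/
noncomputable def innerDerivative (P : ℝ[X][X]) : ℝ[X][X] :=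
  Bivariate.swap (derivative (Bivariate.swap P))

theorem hasDerivAt_evalEval_fst (P : ℝ[X][X]) (t y : ℝ) :
    HasDerivAt (fun t => P.evalEval t y) ((innerDerivative P).evalEval t y) t := by
  have := hasDerivAt_evalEval_snd (Bivariate.swap P) y t
  simpa only [innerDerivative, evalEval_swap] using this

/-- A continuous solution `f` of `P(t, f(t)) = 0` is differentiable where `∂P/∂y ≠ 0`. -/
theorem exists_hasDerivAt_of_evalEval_eq_zero (P : ℝ[X][X]) {f : ℝ → ℝ} {t : ℝ}
    (hf : ContinuousAt f t) (hP : ∀ᶠ u in 𝓝 t, P.evalEval u (f u) = 0)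
    (hd : (derivative P).evalEval t (f t) ≠ 0) :
    ∃ d, HasDerivAt f d t ∧
      (derivative P).evalEval t (f t) * d = -(innerDerivative P).evalEval t (f t) := by
  set F : ℝ → ℝ → ℝ := fun x y => P.evalEval x y
  set F₁ : ℝ → ℝ → ℝ →L[ℝ] ℝ := fun x y =>
    ContinuousLinearMap.toSpanSingleton ℝ ((innerDerivative P).evalEval x y)
  set F₂ : ℝ → ℝ → ℝ →L[ℝ] ℝ := fun x y =>
    ContinuousLinearMap.toSpanSingleton ℝ ((derivative P).evalEval x y)
  set u : ℝ × ℝ := (t, f t) with hu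
  have df₁ : ∀ᶠ v in 𝓝 u, HasFDerivAt (F · v.2) (F₁ v.1 v.2) v.1 :=
    Eventually.of_forall fun v => (hasDerivAt_evalEval_fst P v.1 v.2).hasFDerivAt
  have df₂ : ∀ᶠ v in 𝓝 u, HasFDerivAt (F v.1 ·) (F₂ v.1 v.2) v.2 :=
    Eventually.of_forall fun v => (hasDerivAt_evalEval_snd P v.1 v.2).hasFDerivAt
  have hspan : Continuous fun c : ℝ => ContinuousLinearMap.toSpanSingleton ℝ c :=
    (ContinuousLinearMap.toSpanSingletonCLE (𝕜 := ℝ) (E := ℝ)).continuous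
  have cf₁ : ContinuousAt ↿F₁ u :=
    (hspan.comp (continuous_evalEval (innerDerivative P))).continuousAt
  have cf₂ : ContinuousAt ↿F₂ u := (hspan.comp (continuous_evalEval (derivative P))).continuousAt
  have if₂ : (F₂ u.1 u.2).IsInvertible := by
    refine ⟨ContinuousLinearEquiv.unitsEquivAut ℝ (Units.mk0 _ hd), ?_⟩
    ext
    simp [F₂, hu]
  set ψ := implicitFunctionOfBivariate df₁ df₂ cf₁ cf₂ if₂
  have hψ := hasStrictFDerivAt_implicitFunctionOfBivariate df₁ df₂ cf₁ cf₂ if₂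
  -- Continuity of `f` keeps its graph in the neighbourhood where the implicit function is the only
  -- solution.
  have heq : ∀ᶠ x in 𝓝 t, ψ x = f x := by
    have h1 := eventually_apply_eq_iff_implicitFunctionOfBivariate df₁ df₂ cf₁ cf₂ if₂
    have h2 : Tendsto (fun x => (x, f x)) (𝓝 t) (𝓝 u) := continuousAt_id.prodMk hf
    filter_upwards [h2.eventually h1, hP] with x hx hx0
    exact hx.1 (by simp only [F, hu, hx0, hP.self_of_nhds])
  refine ⟨_, (hψ.hasFDerivAt.hasDerivAt.congr_of_eventuallyEq (heq.mono fun _ h => h.symm)), ?_⟩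
  have h3 : (F₂ u.1 u.2) ((F₂ u.1 u.2).inverse (F₁ u.1 u.2 1)) = F₁ u.1 u.2 1 :=
    if₂.self_apply_inverse _
  simp only [F₁, F₂, ContinuousLinearMap.toSpanSingleton_apply, smul_eq_mul, one_mul, hu] at h3
  simp only [neg_apply, ContinuousLinearMap.comp_apply, F₁, F₂, hu,
    ContinuousLinearMap.toSpanSingleton_apply, smul_eq_mul, one_mul, mul_neg]
  rw [mul_comm, h3]

end Polynomial

namespace IsAlgebraicGerm

variable {f g h : ℝ → ℝ}

theorem exists_hasDerivAt (hf : IsAlgebraicGerm f) :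
    ∃ A B : ℝ → ℝ, IsAlgebraicGerm A ∧ IsAlgebraicGerm B ∧
      ∀ᶠ t in 𝓝[>] (0 : ℝ), B t ≠ 0 ∧ ∃ d, HasDerivAt f d t ∧ B t * d = A t := by
  classical
  -- An annihilating `P` of least degree in `y` is chosen: its derivative cannot annihilate `f`, so
  -- by the dichotomy it is nonzero along the graph near `0⁺`.
  have hex : ∃ m, ∃ P : ℝ[X][X], P ≠ 0 ∧ (∀ᶠ t in 𝓝[>] (0 : ℝ), P.evalEval t (f t) = 0) ∧
      P.natDegree = m := by
    obtain ⟨P, hP, hPf⟩ := isAlgebraic_germ_iff.1 hf.1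
    exact ⟨_, P, hP, hPf, rfl⟩
  obtain ⟨P, hP, hPf, hdeg⟩ := Nat.find_spec hex
  have hdeg0 : P.natDegree ≠ 0 := by
    intro h0
    rw [eq_C_of_natDegree_eq_zero h0] at hPf hP
    simp only [evalEval_C] at hPf
    obtain ⟨t, h1, h2⟩ := (hPf.and (eventually_eval_ne_zero (by simpa using hP))).exists
    exact h2 h1
  have hder0 : derivative P ≠ 0 := fun h0 => hdeg0 (derivative_eq_zero.1 h0)
  have hder : ∀ᶠ t in 𝓝[>] (0 : ℝ), (derivative P).evalEval t (f t) ≠ 0 := by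
    refine (hf.evalEval (derivative P)).eventually_eq_zero_or_ne_zero.resolve_left fun h0 => ?_
    refine Nat.find_min hex (m := (derivative P).natDegree) ?_ ⟨_, hder0, h0, rfl⟩
    rw [← hdeg]
    exact natDegree_derivative_lt hdeg0
  refine ⟨fun t => -(innerDerivative P).evalEval t (f t), fun t => (derivative P).evalEval t (f t),
    by simpa using (const 0).sub (hf.evalEval (innerDerivative P)), hf.evalEval _, ?_⟩
  obtain ⟨δ, hδ, hall⟩ := eventually_nhdsGT_zero_iff.1 (hPf.and (hder.and hf.2))
  refine eventually_nhdsGT_zero_iff.2 ⟨δ, hδ, fun t ht => ⟨(hall t ht).2.1, ?_⟩⟩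
  refine exists_hasDerivAt_of_evalEval_eq_zero P (hall t ht).2.2 ?_ (hall t ht).2.1
  filter_upwards [isOpen_Ioo.mem_nhds ht] with u hu using (hall u hu).1

/-- A continuous algebraic function is strictly monotone or constant near `0⁺`. -/
theorem exists_strictMonoOn_or (hf : IsAlgebraicGerm f) :
    ∃ δ > 0, StrictMonoOn f (Ioo 0 δ) ∨ StrictAntiOn f (Ioo 0 δ) ∨
      ∀ x ∈ Ioo 0 δ, ∀ y ∈ Ioo 0 δ, f x = f y := by
  obtain ⟨A, B, hA, hB, hAB⟩ := hf.exists_hasDerivAt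
  -- From `B * f' = A`, the product `A * B = B ^ 2 * f'` has the sign of `f'`.
  have hsign := (hA.mul hB).eventually_sign
  have hd : ∀ᶠ t in 𝓝[>] (0 : ℝ), DifferentiableAt ℝ f t ∧ B t ≠ 0 ∧
      A t * B t = B t ^ 2 * deriv f t := by
    filter_upwards [hAB] with t ⟨h0, d, h1, h2⟩
    refine ⟨h1.differentiableAt, h0, ?_⟩
    rw [h1.deriv, ← h2]
    ring
  rcases hsign with hs | hs | hs <;>
  · obtain ⟨δ, hδ, h⟩ := eventually_nhdsGT_zero_iff.1 (hs.and hd)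
    have hc : ContinuousOn f (Ioo 0 δ) := fun t ht => (h t ht).2.1.continuousAt.continuousWithinAt
    refine ⟨δ, hδ, ?_⟩
    first
    | refine .inl (strictMonoOn_of_deriv_pos (convex_Ioo 0 δ) hc fun t ht => ?_)
      rw [interior_Ioo] at ht
      obtain ⟨h1, -, h2, h3⟩ := h t ht
      rw [h3] at h1
      exact pos_of_mul_pos_right h1 (sq_nonneg _)
    | refine .inr (.inl (strictAntiOn_of_deriv_neg (convex_Ioo 0 δ) hc fun t ht => ?_))
      rw [interior_Ioo] at ht
      obtain ⟨h1, -, h2, h3⟩ := h t ht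
      rw [h3] at h1
      exact neg_of_mul_neg_right h1 (sq_nonneg _)
    | refine .inr (.inr fun x hx y hy => ?_)
      refine isOpen_Ioo.is_const_of_deriv_eq_zero isPreconnected_Ioo
        (fun t ht => (h t ht).2.1.differentiableWithinAt) (fun t ht => ?_) hx hy
      obtain ⟨h1, -, h2, h3⟩ := h t ht
      rw [h3] at h1
      simpa [h2] using h1

theorem exists_monotoneOn_or_antitoneOn (hf : IsAlgebraicGerm f) :
    ∃ δ > 0, MonotoneOn f (Ioo 0 δ) ∨ AntitoneOn f (Ioo 0 δ) := by
  obtain ⟨δ, hδ, h | h | h⟩ := hf.exists_strictMonoOn_or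
  · exact ⟨δ, hδ, .inl h.monotoneOn⟩
  · exact ⟨δ, hδ, .inr h.antitoneOn⟩
  · exact ⟨δ, hδ, .inl fun x hx y hy _ => (h x hx y hy).le⟩

/-- Substituting `h` for `t` in the coefficients of a relation for `f` gives one for `f ∘ h` over
`algebraicGerms`, which is itself algebraic over `ℝ[X]`. The relation stays nontrivial because `h`
tends to `0` through positive values, where a nonzero polynomial does not vanish. -/
theorem comp (hf : IsAlgebraicGerm f) (hh : IsAlgebraicGerm h)
    (h0 : Tendsto h (𝓝[>] 0) (𝓝[>] 0)) : IsAlgebraicGerm (f ∘ h) := by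
  refine ⟨?_, ?_⟩
  · obtain ⟨P, hP, hPf⟩ := isAlgebraic_germ_iff.1 hf.1
    let H : algebraicGerms := ⟨h, h, hh, rfl⟩
    let φ : ℝ[X] →+* algebraicGerms := eval₂RingHom ((algebraMap ℝ[X] algebraicGerms).comp C) H
    have hφ : ∀ a : ℝ[X], (φ a : Germ (𝓝[>] (0 : ℝ)) ℝ)
        = ((fun t => a.eval (h t) : ℝ → ℝ) : Germ _ ℝ) := by
      intro a
      have : (algebraicGerms.val.toRingHom).comp φ
          = (Germ.coeRingHom (𝓝[>] (0 : ℝ))).comp (RingHom.pi fun t : ℝ => evalRingHom (h t)) := by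
        refine Polynomial.ringHom_ext (fun r => ?_) ?_
        · simp only [φ, RingHom.comp_apply, coe_eval₂RingHom, eval₂_C]
          refine congrArg (Germ.ofFun (l := 𝓝[>] (0 : ℝ))) ?_
          ext t
          simp
        · simp only [φ, RingHom.comp_apply, coe_eval₂RingHom, eval₂_X]
          refine congrArg (Germ.ofFun (l := 𝓝[>] (0 : ℝ))) ?_
          ext t
          simp
      exact RingHom.congr_fun this a
    have hφ0 : ∀ a : ℝ[X], a ≠ 0 → φ a ≠ 0 := by
      intro a ha h1
      have h2 := hφ a
      rw [h1] at h2
      have h3 : ∀ᶠ t in 𝓝[>] (0 : ℝ), 0 = a.eval (h t) := Germ.coe_eq.1 h2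
      obtain ⟨t, h4, h5⟩ := (h3.and (h0.eventually (eventually_eval_ne_zero ha))).exists
      exact h5 h4.symm
    have halg : IsAlgebraic algebraicGerms ((f ∘ h : ℝ → ℝ) : Germ (𝓝[>] (0 : ℝ)) ℝ) := by
      refine ⟨P.map φ, ?_, ?_⟩
      · rwa [Ne, Polynomial.map_eq_zero_iff ((injective_iff_map_eq_zero φ).2
          fun a ha => by_contra fun h => hφ0 a h ha)]
      · have hgen : ∀ P : ℝ[X][X], aeval ((f ∘ h : ℝ → ℝ) : Germ (𝓝[>] (0 : ℝ)) ℝ) (P.map φ)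
            = ((fun t => P.evalEval (h t) (f (h t)) : ℝ → ℝ) : Germ (𝓝[>] (0 : ℝ)) ℝ) := by
          intro P
          induction P using Polynomial.induction_on' with
          | add p q hp hq =>
            rw [Polynomial.map_add, map_add, hp, hq, ← Germ.coe_add]
            congr 1
            ext t
            simp [evalEval_add]
          | monomial n a =>
            rw [map_monomial, aeval_monomial, ← Germ.coe_pow]
            refine (congrArg (· * _) (hφ a)).trans ?_
            simp only [← Germ.coe_mul]
            congr 1
            ext t
            simp [Polynomial.evalEval, eval_monomial]
        rw [hgen]
        exact Germ.coe_eq.2 (h0.eventually hPf)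
    exact halg.restrictScalars ℝ[X]
  · filter_upwards [hh.2, h0.eventually hf.2] with t h1 h2 using ContinuousAt.comp h2 h1

theorem of_rightInverse (hf : IsAlgebraicGerm f) (h0 : Tendsto h (𝓝[>] 0) (𝓝[>] 0))
    (hfh : ∀ᶠ r in 𝓝[>] (0 : ℝ), f (h r) = r) (hc : ∀ᶠ r in 𝓝[>] (0 : ℝ), ContinuousAt h r) :
    IsAlgebraicGerm h := by
  refine ⟨?_, hc⟩
  obtain ⟨P, hP, hPf⟩ := isAlgebraic_germ_iff.1 hf.1
  refine isAlgebraic_germ_iff.2 ⟨Bivariate.swap P, by simpa using hP, ?_⟩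
  filter_upwards [h0.eventually hPf, hfh] with r h1 h2
  rw [evalEval_swap]
  rwa [h2] at h1

/-- A bounded quotient without a limit would lie infinitely often below some `a` and above some `b >
a`, but `f - a * g` has constant sign near `0⁺`. -/
theorem exists_tendsto_div (hf : IsAlgebraicGerm f) (hg : IsAlgebraicGerm g)
    (hpos : ∀ᶠ t in 𝓝[>] (0 : ℝ), 0 < g t) (hfg : ∀ᶠ t in 𝓝[>] (0 : ℝ), |f t| ≤ g t) :
    ∃ L, Tendsto (fun t => f t / g t) (𝓝[>] 0) (𝓝 L) := by
  have hbd : ∀ᶠ t in 𝓝[>] (0 : ℝ), |f t / g t| ≤ 1 := by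
    filter_upwards [hpos, hfg] with t h1 h2
    rw [abs_div, abs_of_pos h1]
    exact (div_le_one h1).2 h2
  refine tendsto_of_no_upcrossings dense_univ (fun a _ b _ hab => ?_)
    ⟨1, by simpa using hbd.mono fun t ht => (abs_le.1 ht).2⟩
    ⟨-1, by simpa using hbd.mono fun t ht => (abs_le.1 ht).1⟩
  rintro ⟨h1, h2⟩
  have hle : (∀ᶠ t in 𝓝[>] (0 : ℝ), f t - a * g t < 0) ∨
      ∀ᶠ t in 𝓝[>] (0 : ℝ), 0 ≤ f t - a * g t := by
    rcases (hf.sub ((const a).mul hg)).eventually_sign with h | h | h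
    · exact .inr (h.mono fun _ h => h.ge)
    · exact .inr (h.mono fun _ h => h.le)
    · exact .inl h
  rcases hle with h | h
  · obtain ⟨t, h3, h4, h5⟩ := (h2.and_eventually (h.and hpos)).exists
    rw [lt_div_iff₀ h5] at h3
    nlinarith
  · obtain ⟨t, h3, h4, h5⟩ := (h1.and_eventually (h.and hpos)).exists
    rw [div_lt_iff₀ h5] at h3
    linarith

end IsAlgebraicGerm

/-! ### Parametrization by the distance to the origin -/

/-- A curve with continuous algebraic coordinates that are monotone, parametrized by the distance
to the origin. -/
structure IsRadialCurve {n : ℕ} (σ : ℝ → EuclideanSpace ℝ (Fin n)) (R : ℝ) : Prop where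
  pos : 0 < R
  continuousOn : ContinuousOn σ (Icc 0 R)
  norm_eq : ∀ r ∈ Icc 0 R, ‖σ r‖ = r
  isAlgebraicGerm : ∀ i, IsAlgebraicGerm fun r => σ r i
  monotoneOn_or : ∀ i, MonotoneOn (fun r => σ r i) (Icc 0 R) ∨ AntitoneOn (fun r => σ r i) (Icc 0 R)

theorem IsRadialCurve.mono {n : ℕ} {σ : ℝ → EuclideanSpace ℝ (Fin n)} {R R' : ℝ}
    (h : IsRadialCurve σ R) (h0 : 0 < R') (hR : R' ≤ R) : IsRadialCurve σ R' :=
  have hs := Icc_subset_Icc_right hR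
  ⟨h0, h.continuousOn.mono hs, fun r hr => h.norm_eq r (hs hr), h.isAlgebraicGerm,
    fun i => (h.monotoneOn_or i).imp (·.mono hs) (·.mono hs)⟩

theorem MonotoneOn.Ico_of_Ioo {f : ℝ → ℝ} {a b : ℝ} (hf : MonotoneOn f (Ioo a b))
    (hc : ContinuousOn f (Ico a b)) : MonotoneOn f (Ico a b) := by
  intro x hx y hy hxy
  rcases hx.1.eq_or_lt with rfl | hx0
  · rcases hxy.eq_or_lt with rfl | hlt
    · rfl
    have h1 : Tendsto f (𝓝[>] a) (𝓝 (f a)) :=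
      (hc a hx).mono_left (nhdsWithin_le_iff.2 (mem_of_superset (Ioo_mem_nhdsGT hx.2)
        Ioo_subset_Ico_self))
    refine le_of_tendsto h1 ?_
    filter_upwards [Ioo_mem_nhdsGT hlt] with z hz
    exact hf ⟨hz.1, hz.2.trans hy.2⟩ ⟨hlt, hy.2⟩ hz.2.le
  · exact hf ⟨hx0, hx.2⟩ ⟨hx0.trans_le hxy, hy.2⟩ hxy

/-- A nonnegative, not eventually vanishing algebraic germ with limit `0` is strictly monotone. -/
theorem IsAlgebraicGerm.exists_strictMonoOn_Icc {ρ : ℝ → ℝ} (hρ : IsAlgebraicGerm ρ)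
    (hc : ContinuousOn ρ (Ico 0 1)) (h0 : ρ 0 = 0) (hnn : ∀ t, 0 ≤ ρ t)
    (hne : ∃ᶠ t in 𝓝[>] (0 : ℝ), ρ t ≠ 0) :
    ∃ D, 0 < D ∧ D < 1 ∧ StrictMonoOn ρ (Icc 0 D) := by
  have hlim : Tendsto ρ (𝓝[>] 0) (𝓝 0) := by
    have h1 : ContinuousWithinAt ρ (Ico 0 1) 0 := hc 0 ⟨le_rfl, one_pos⟩
    rw [ContinuousWithinAt, h0] at h1
    exact h1.mono_left (nhdsWithin_le_iff.2 (mem_of_superset (Ioo_mem_nhdsGT one_pos)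
        Ioo_subset_Ico_self))
  have hpos : ∀ᶠ t in 𝓝[>] (0 : ℝ), 0 < ρ t := by
    refine (hρ.eventually_eq_zero_or_ne_zero.resolve_left fun h => ?_).mono
      fun t ht => (hnn t).lt_of_ne' ht
    exact hne (h.mono fun t ht => not_not.2 ht)
  obtain ⟨δ₁, hδ₁, hpos⟩ := eventually_nhdsGT_zero_iff.1 hpos
  obtain ⟨δ₂, hδ₂, hmono⟩ := hρ.exists_strictMonoOn_or
  set δ := min (min δ₁ δ₂) 1 with hδ
  have hδ0 : 0 < δ := by positivity
  have h₁ : δ ≤ δ₁ := (min_le_left _ _).trans (min_le_left _ _)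
  have h₂ : δ ≤ δ₂ := (min_le_left _ _).trans (min_le_right _ _)
  have hmid : δ / 2 ∈ Ioo 0 δ₂ := ⟨by positivity, by linarith⟩
  have hmidpos : 0 < ρ (δ / 2) := hpos _ ⟨by positivity, by linarith⟩
  -- The limit `0` at `0⁺` excludes the decreasing and the constant case.
  have hcontra : ¬ ∀ t ∈ Ioo 0 (δ / 2), ρ (δ / 2) ≤ ρ t := by
    intro h
    refine hmidpos.not_ge (ge_of_tendsto hlim ?_)
    exact eventually_nhdsGT_zero_iff.2 ⟨δ / 2, by positivity, h⟩
  have hstrict : StrictMonoOn ρ (Ioo 0 δ₂) := by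
    rcases hmono with h | h | h
    · exact h
    · exact absurd (fun t ht => (h ⟨ht.1, ht.2.trans hmid.2⟩ hmid ht.2).le) hcontra
    · exact absurd (fun t ht => (h _ hmid t ⟨ht.1, ht.2.trans hmid.2⟩).le) hcontra
  refine ⟨δ / 2, by positivity, by linarith [min_le_right (min δ₁ δ₂) 1], ?_⟩
  intro x hx y hy hxy
  rcases hx.1.eq_or_lt with rfl | hx0
  · rw [h0]
    exact hpos y ⟨hxy, by linarith [hy.2]⟩
  · exact hstrict ⟨hx0, by linarith [hx.2]⟩ ⟨hx0.trans hxy, by linarith [hy.2]⟩ hxy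

/-- The inverse of a continuous strictly increasing function on a compact interval. -/
theorem StrictMonoOn.exists_continuousOn_inverse {ρ : ℝ → ℝ} {D : ℝ} (hD : 0 < D)
    (hmono : StrictMonoOn ρ (Icc 0 D)) (hc : ContinuousOn ρ (Icc 0 D)) :
    ∃ h : ℝ → ℝ, ContinuousOn h (Icc (ρ 0) (ρ D)) ∧
      (∀ r ∈ Icc (ρ 0) (ρ D), h r ∈ Icc 0 D ∧ ρ (h r) = r) ∧ ∀ t ∈ Icc 0 D, h (ρ t) = t := by
  have himg : ρ '' Icc 0 D = Icc (ρ 0) (ρ D) := by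
    refine Subset.antisymm ?_ (intermediate_value_Icc hD.le hc)
    rintro _ ⟨t, ht, rfl⟩
    exact ⟨hmono.monotoneOn ⟨le_rfl, hD.le⟩ ht ht.1, hmono.monotoneOn ht ⟨hD.le, le_rfl⟩ ht.2⟩
  set h := Function.invFunOn ρ (Icc 0 D) with hh
  have hleft : ∀ t ∈ Icc 0 D, h (ρ t) = t := fun t ht => hmono.injOn.leftInvOn_invFunOn ht
  refine ⟨h, ?_, fun r hr => ?_, hleft⟩
  · rw [← himg, continuousOn_iff_continuous_domRestrict]
    have : OrdConnected (ρ '' Icc 0 D) := himg ▸ ordConnected_Icc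
    have heq : (ρ '' Icc 0 D).domRestrict h
        = Subtype.val ∘ (hmono.orderIso ρ (Icc 0 D)).symm := by
      ext ⟨_, t, ht, rfl⟩
      have h1 : (hmono.orderIso ρ (Icc 0 D)).symm ⟨ρ t, t, ht, rfl⟩ = ⟨t, ht⟩ := by
        rw [OrderIso.symm_apply_eq]
        rfl
      simp only [domRestrict_apply, Function.comp_apply, h1]
      exact hleft t ht
    rw [heq]
    exact continuous_subtype_val.comp (OrderIso.continuous _)
  · rw [← himg] at hr
    exact ⟨Function.invFunOn_mem hr, Function.invFunOn_eq hr⟩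

/-- Take `σ = γ ∘ h` with `h` the inverse of `‖γ‖` near `0`; then `arc γ ε` corresponds to the
radius `‖γ ε‖`. The bound `R'` leaves room to shrink the radius later. -/
theorem IsSemialgebraicCurve.exists_isRadialCurve {n : ℕ} {γ : ℝ → EuclideanSpace ℝ (Fin n)}
    (hγ : IsSemialgebraicCurve γ) (hn : NonconstantGerm γ) :
    ∃ σ R, IsRadialCurve σ R ∧ ∀ R' > 0, R' ≤ R →
      ∀ᶠ ε in 𝓝[>] (0 : ℝ), ∃ r ∈ Ioc 0 R', arc γ ε = σ '' Ico 0 r := by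
  have hcoordc : ∀ i, ContinuousOn (fun t => γ t i) (Ico 0 1) := fun i =>
    (EuclideanSpace.proj (𝕜 := ℝ) i).continuous.comp_continuousOn hγ.continuousOn
  have hcoord : ∀ i, IsAlgebraicGerm fun t => γ t i := by
    intro i
    refine ⟨isAlgebraic_germ_iff.2 ?_, ?_⟩
    · obtain ⟨P, hP, h⟩ := hγ.semialgebraic_graph.exists_bivariate_vanishing_on_graph i
      exact ⟨P, hP, eventually_nhdsGT_zero_iff.2 ⟨1, one_pos, fun t ht => h t ⟨ht.1.le, ht.2⟩⟩⟩
    · refine eventually_nhdsGT_zero_iff.2 ⟨1, one_pos, fun t ht => ?_⟩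
      exact (hcoordc i).continuousAt (mem_of_superset (isOpen_Ioo.mem_nhds ht) Ioo_subset_Ico_self)
  set ρ : ℝ → ℝ := fun t => ‖γ t‖ with hρdef
  have hρ : IsAlgebraicGerm ρ := by
    have h1 := (IsAlgebraicGerm.sum Finset.univ (fun i t => γ t i * γ t i)
      fun i _ => (hcoord i).mul (hcoord i)).sqrt
      fun t => Finset.sum_nonneg fun i _ => mul_self_nonneg _
    convert h1 using 2 with t
    simp [hρdef, EuclideanSpace.norm_eq, sq]
  have hρc : ContinuousOn ρ (Ico 0 1) := hγ.continuousOn.norm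
  have hρ0 : ρ 0 = 0 := by simp [hρdef, hγ.map_zero]
  obtain ⟨D, hD, hD1, hmono⟩ := hρ.exists_strictMonoOn_Icc hρc hρ0 (fun t => norm_nonneg _)
    (hn.mono fun t ht => by rw [hγ.map_zero] at ht; simpa [hρdef] using ht)
  have hDs : Icc 0 D ⊆ Ico 0 1 := fun t ht => ⟨ht.1, ht.2.trans_lt hD1⟩
  obtain ⟨h, hhc, hhr, hhl⟩ := hmono.exists_continuousOn_inverse hD (hρc.mono hDs)
  rw [hρ0] at hhc hhr
  have hRR : 0 < ρ D := by rw [← hρ0]; exact hmono ⟨le_rfl, hD.le⟩ ⟨hD.le, le_rfl⟩ hD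
  have hh0 : h 0 = 0 := by simpa [hρ0] using hhl 0 ⟨le_rfl, hD.le⟩
  have hhpos : ∀ r ∈ Ioo 0 (ρ D), 0 < h r := by
    intro r hr
    obtain ⟨h1, h2⟩ := hhr r ⟨hr.1.le, hr.2.le⟩
    refine h1.1.lt_of_ne fun h3 => hr.1.ne ?_
    rw [← h2, ← h3, hρ0]
  have hhlim : Tendsto h (𝓝[>] 0) (𝓝[>] 0) := by
    refine tendsto_nhdsWithin_iff.2 ⟨?_, eventually_nhdsGT_zero_iff.2 ⟨_, hRR, hhpos⟩⟩
    have h1 : ContinuousWithinAt h (Icc 0 (ρ D)) 0 := hhc 0 ⟨le_rfl, hRR.le⟩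
    rw [ContinuousWithinAt, hh0] at h1
    exact h1.mono_left (nhdsWithin_le_iff.2 (mem_of_superset (Ioo_mem_nhdsGT hRR)
        Ioo_subset_Icc_self))
  have hhalg : IsAlgebraicGerm h := by
    refine hρ.of_rightInverse hhlim ?_ ?_
    · exact eventually_nhdsGT_zero_iff.2 ⟨_, hRR, fun r hr => (hhr r ⟨hr.1.le, hr.2.le⟩).2⟩
    · exact eventually_nhdsGT_zero_iff.2 ⟨_, hRR, fun r hr =>
        hhc.continuousAt (Icc_mem_nhds hr.1 hr.2)⟩
  set σ : ℝ → EuclideanSpace ℝ (Fin n) := γ ∘ h with hσ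
  have hσalg : ∀ i, IsAlgebraicGerm fun r => σ r i := fun i => (hcoord i).comp hhalg hhlim
  have hσc : ContinuousOn σ (Icc 0 (ρ D)) :=
    (hγ.continuousOn.mono hDs).comp hhc fun r hr => (hhr r hr).1
  have hσic : ∀ i, ContinuousOn (fun r => σ r i) (Icc 0 (ρ D)) := fun i =>
    (EuclideanSpace.proj (𝕜 := ℝ) i).continuous.comp_continuousOn hσc
  choose δ hδ hmon using fun i => (hσalg i).exists_monotoneOn_or_antitoneOn
  have hev : ∀ᶠ r in 𝓝[>] (0 : ℝ), r < ρ D ∧ ∀ i, r < δ i := by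
    have h1 : ∀ c > (0 : ℝ), ∀ᶠ r in 𝓝[>] (0 : ℝ), r < c := fun c hc => by
      filter_upwards [Ioo_mem_nhdsGT hc] with r hr using hr.2
    exact (h1 _ hRR).and (eventually_all.2 fun i => h1 _ (hδ i))
  obtain ⟨R, ⟨hRD, hRδ⟩, hR0⟩ := (hev.and self_mem_nhdsWithin).exists
  have hR0 : 0 < R := hR0
  refine ⟨σ, R, ⟨hR0, hσc.mono (Icc_subset_Icc_right hRD.le), fun r hr => ?_, hσalg, fun i => ?_⟩,
    fun R' hR' hR'R => ?_⟩
  · exact (hhr r ⟨hr.1, hr.2.trans hRD.le⟩).2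
  · set b := min (δ i) (ρ D) with hb
    have hRb : R < b := lt_min (hRδ i) hRD
    have hs : Icc 0 R ⊆ Ico 0 b := fun x hx => ⟨hx.1, hx.2.trans_lt hRb⟩
    have hs1 : Ioo 0 b ⊆ Ioo 0 (δ i) := Ioo_subset_Ioo_right (min_le_left _ _)
    have hs2 : Ico 0 b ⊆ Icc 0 (ρ D) := fun x hx => ⟨hx.1, hx.2.le.trans (min_le_right _ _)⟩
    rcases hmon i with h1 | h1
    · exact .inl (((h1.mono hs1).Ico_of_Ioo ((hσic i).mono hs2)).mono hs)
    · have h2 := ((h1.mono hs1).neg.Ico_of_Ioo ((hσic i).mono hs2).neg).mono hs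
      exact .inr fun x hx y hy hxy => neg_le_neg_iff.1 (h2 hx hy hxy)
  · have hρlim : Tendsto ρ (𝓝[>] 0) (𝓝 0) := by
      have h1 : ContinuousWithinAt ρ (Ico 0 1) 0 := hρc 0 ⟨le_rfl, one_pos⟩
      rw [ContinuousWithinAt, hρ0] at h1
      exact h1.mono_left (nhdsWithin_le_iff.2 (mem_of_superset (Ioo_mem_nhdsGT one_pos)
        Ioo_subset_Ico_self))
    filter_upwards [hρlim.eventually_le_const hR', Ioo_mem_nhdsGT hD] with ε hε hεD
    have hεD' : ε ∈ Icc 0 D := ⟨hεD.1.le, hεD.2.le⟩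
    have h0D : (0 : ℝ) ∈ Icc 0 D := ⟨le_rfl, hD.le⟩
    refine ⟨ρ ε, ⟨by rw [← hρ0]; exact hmono h0D hεD' hεD.1, hε⟩, ?_⟩
    ext x
    constructor
    · rintro ⟨t, ht, rfl⟩
      have htD : t ∈ Icc 0 D := ⟨ht.1, ht.2.le.trans hεD.2.le⟩
      exact ⟨ρ t, ⟨norm_nonneg _, hmono htD hεD' ht.2⟩, by simp [hσ, hhl t htD]⟩
    · rintro ⟨r, hr, rfl⟩
      obtain ⟨h1, h2⟩ := hhr r ⟨hr.1, hr.2.le.trans (hε.trans (hR'R.trans hRD.le))⟩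
      refine ⟨h r, ⟨h1.1, ?_⟩, rfl⟩
      by_contra! h3
      have := hmono.monotoneOn hεD' h1 h3
      rw [h2] at this
      exact absurd hr.2 this.not_gt

/-! ### Tangent direction and tangent cone -/

theorem IsRadialCurve.exists_direction {n : ℕ} {σ : ℝ → EuclideanSpace ℝ (Fin n)} {R : ℝ}
    (h : IsRadialCurve σ R) :
    ∃ v, ‖v‖ = 1 ∧ ∀ η > 0, ∃ δ > 0, ∀ r ∈ Ico 0 δ, ‖σ r - r • v‖ ≤ η * r := by
  have hmem : ∀ᶠ r in 𝓝[>] (0 : ℝ), r ∈ Ioo 0 R := Ioo_mem_nhdsGT h.pos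
  have hid : IsAlgebraicGerm fun t => t := by simpa using IsAlgebraicGerm.polynomial X
  have hL : ∀ i, ∃ L, Tendsto (fun r => σ r i / r) (𝓝[>] 0) (𝓝 L) := fun i => by
    refine (h.isAlgebraicGerm i).exists_tendsto_div hid self_mem_nhdsWithin ?_
    filter_upwards [hmem] with r hr
    rw [← h.norm_eq r ⟨hr.1.le, hr.2.le⟩]
    simpa [h.norm_eq r ⟨hr.1.le, hr.2.le⟩] using PiLp.norm_apply_le (σ r) i
  choose L hL using hL
  have hlim : Tendsto (fun r => r⁻¹ • σ r) (𝓝[>] 0) (𝓝 (WithLp.toLp 2 L)) := by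
    have h1 : Tendsto (fun r i => σ r i / r) (𝓝[>] 0) (𝓝 L) := tendsto_pi_nhds.2 hL
    refine (((PiLp.continuous_toLp 2 fun _ : Fin n => ℝ).tendsto L).comp h1).congr fun r => ?_
    ext i
    simp [div_eq_inv_mul]
  refine ⟨WithLp.toLp 2 L, ?_, fun η hη => ?_⟩
  · refine tendsto_nhds_unique hlim.norm (tendsto_const_nhds.congr' ?_)
    filter_upwards [hmem] with r hr
    rw [norm_smul, h.norm_eq r ⟨hr.1.le, hr.2.le⟩, norm_inv, Real.norm_of_nonneg hr.1.le,
      inv_mul_cancel₀ hr.1.ne']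
  · have h2 : ∀ᶠ r in 𝓝[>] (0 : ℝ), dist (r⁻¹ • σ r) (WithLp.toLp 2 L) < η :=
      hlim.eventually (Metric.ball_mem_nhds _ hη)
    obtain ⟨δ, hδ, h3⟩ := eventually_nhdsGT_zero_iff.1 h2
    refine ⟨δ, hδ, fun r hr => ?_⟩
    rcases hr.1.eq_or_lt with rfl | hr0
    · have : σ 0 = 0 := norm_eq_zero.1 (h.norm_eq 0 ⟨le_rfl, h.pos.le⟩)
      simp [this]
    · have h4 := (h3 r ⟨hr0, hr.2⟩).le
      have h5 : σ r - r • WithLp.toLp 2 L = r • (r⁻¹ • σ r - WithLp.toLp 2 L) := by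
        rw [smul_sub, smul_inv_smul₀ hr0.ne']
      rw [h5, norm_smul, Real.norm_of_nonneg hr.1, mul_comm, ← dist_eq_norm]
      exact mul_le_mul_of_nonneg_right h4 hr.1

/-- As `‖σ r‖ = r`, convergence of `t k • σ (r k)` to `w` forces `t k * r k → ‖w‖`, and the
first-order expansion identifies `w` with `‖w‖ • v`. -/
theorem IsRadialCurve.peanoTangentCone_eq {n : ℕ} {σ : ℝ → EuclideanSpace ℝ (Fin n)} {R a : ℝ}
    (h : IsRadialCurve σ R) {v : EuclideanSpace ℝ (Fin n)}
    (hv : ∀ η > 0, ∃ δ > 0, ∀ r ∈ Ico 0 δ, ‖σ r - r • v‖ ≤ η * r) (ha : 0 < a) (haR : a ≤ R) :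
    peanoTangentCone (σ '' Ico 0 a) 0 = halfLine v := by
  ext w
  constructor
  · rintro ⟨x, t, hx, hx0, ht, hw⟩
    simp only [sub_zero] at hw
    choose r hr hrx using hx
    have hnorm : ∀ k, ‖x k‖ = r k := fun k => by
      rw [← hrx k]; exact h.norm_eq _ ⟨(hr k).1, (hr k).2.le.trans haR⟩
    have hr0 : Tendsto r atTop (𝓝 0) := by simpa [hnorm] using hx0.norm
    have htr : Tendsto (fun k => t k * r k) atTop (𝓝 ‖w‖) := by
      refine hw.norm.congr fun k => ?_
      rw [norm_smul, hnorm, Real.norm_of_nonneg (ht k).le]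
    refine ⟨‖w‖, norm_nonneg _, ?_⟩
    have hle : ∀ η > 0, ‖w - ‖w‖ • v‖ ≤ η * ‖w‖ := by
      intro η hη
      obtain ⟨δ, hδ, hδv⟩ := hv η hη
      refine le_of_tendsto_of_tendsto (hw.sub (htr.smul_const v)).norm (htr.const_mul η) ?_
      filter_upwards [hr0.eventually_lt_const hδ] with k hk
      have h1 := hδv (r k) ⟨(hr k).1, hk⟩
      have h2 : t k • x k - (t k * r k) • v = t k • (σ (r k) - r k • v) := by
        rw [hrx, smul_sub, smul_smul]
      rw [h2, norm_smul, Real.norm_of_nonneg (ht k).le]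
      calc t k * ‖σ (r k) - r k • v‖ ≤ t k * (η * r k) := mul_le_mul_of_nonneg_left h1 (ht k).le
        _ = η * (t k * r k) := by ring
    have h0 : ‖w - ‖w‖ • v‖ ≤ 0 := by
      have hlim : Tendsto (fun η : ℝ => η * ‖w‖) (𝓝[>] 0) (𝓝 (0 * ‖w‖)) :=
        (tendsto_nhdsWithin_of_tendsto_nhds tendsto_id).mul_const _
      rw [zero_mul] at hlim
      exact ge_of_tendsto hlim (eventually_mem_nhdsWithin.mono fun η hη => hle η hη)
    exact sub_eq_zero.1 (norm_le_zero_iff.1 h0)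
  · rintro ⟨s, hs, rfl⟩
    set r : ℕ → ℝ := fun k => a / (k + 2) with hr
    have hrpos : ∀ k, 0 < r k := fun k => by positivity
    have hra : ∀ k, r k < a := fun k => div_lt_self ha (by linarith [k.cast_nonneg (α := ℝ)])
    have hr0 : Tendsto r atTop (𝓝 0) := by
      have h1 : Tendsto (fun k : ℕ => (k : ℝ) + 2) atTop atTop :=
        tendsto_natCast_atTop_atTop.atTop_add tendsto_const_nhds
      exact h1.const_div_atTop a
    have hnorm : ∀ k, ‖σ (r k)‖ = r k := fun k =>
      h.norm_eq _ ⟨(hrpos k).le, (hra k).le.trans haR⟩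
    have hu : Tendsto (fun k => (r k)⁻¹ • σ (r k)) atTop (𝓝 v) := by
      rw [Metric.tendsto_atTop']
      intro η hη
      obtain ⟨δ, hδ, hδv⟩ := hv (η / 2) (by positivity)
      obtain ⟨N, hN⟩ := eventually_atTop.1 (hr0.eventually_lt_const hδ)
      refine ⟨N, fun k hk => ?_⟩
      have h1 := hδv (r k) ⟨(hrpos k).le, hN k hk.le⟩
      have h2 : (r k)⁻¹ • σ (r k) - v = (r k)⁻¹ • (σ (r k) - r k • v) := by
        rw [smul_sub, inv_smul_smul₀ (hrpos k).ne']
      rw [dist_eq_norm, h2, norm_smul, norm_inv, Real.norm_of_nonneg (hrpos k).le,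
        inv_mul_lt_iff₀ (hrpos k)]
      nlinarith [hrpos k]
    -- The summand `1 / (k + 1)` keeps the multipliers positive when `s = 0`.
    refine ⟨fun k => σ (r k), fun k => (s + 1 / ((k : ℝ) + 1)) * (r k)⁻¹,
      fun k => mem_image_of_mem _ ⟨(hrpos k).le, hra k⟩, ?_, fun k => ?_, ?_⟩
    · rw [tendsto_zero_iff_norm_tendsto_zero]
      simpa [hnorm] using hr0
    · have := hrpos k
      positivity
    · simp only [sub_zero, mul_smul]
      have h1 : Tendsto (fun k : ℕ => s + 1 / ((k : ℝ) + 1)) atTop (𝓝 (s + 0)) :=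
        tendsto_const_nhds.add tendsto_one_div_add_atTop_nhds_zero_nat
      simpa using h1.smul hu

theorem halfLine_eq_halfLine_iff {n : ℕ} {v w : EuclideanSpace ℝ (Fin n)} (hv : ‖v‖ = 1)
    (hw : ‖w‖ = 1) : halfLine v = halfLine w ↔ v = w := by
  refine ⟨fun h => ?_, fun h => h ▸ rfl⟩
  have : v ∈ halfLine w := h ▸ ⟨1, zero_le_one, (one_smul ℝ v).symm⟩
  obtain ⟨s, hs, hvs⟩ := this
  have h1 : s = 1 := by
    rw [hvs, norm_smul, hw, mul_one, Real.norm_of_nonneg hs] at hv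
    exact hv
  rw [hvs, h1, one_smul]

/-! ### Coincidence of germs, and tangent arcs -/

theorem IsRadialCurve.sameGermAt {n : ℕ} {σ₁ σ₂ : ℝ → EuclideanSpace ℝ (Fin n)} {R a b : ℝ}
    (h₁ : IsRadialCurve σ₁ R) (h₂ : IsRadialCurve σ₂ R)
    (heq : ∀ᶠ r in 𝓝[>] (0 : ℝ), σ₁ r = σ₂ r) (ha : a ∈ Ioc 0 R) (hb : b ∈ Ioc 0 R) :
    SameGermAt (σ₁ '' Ico 0 a) (σ₂ '' Ico 0 b) 0 := by
  obtain ⟨δ, hδ, hδeq⟩ := eventually_nhdsGT_zero_iff.1 heq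
  have heq0 : ∀ r ∈ Ico 0 δ, σ₁ r = σ₂ r := by
    intro r hr
    rcases hr.1.eq_or_lt with rfl | hr0
    · have h0 : (0 : ℝ) ∈ Icc 0 R := ⟨le_rfl, h₁.pos.le⟩
      rw [norm_eq_zero.1 (h₁.norm_eq 0 h0), norm_eq_zero.1 (h₂.norm_eq 0 h0)]
    · exact hδeq r ⟨hr0, hr.2⟩
  have hm : 0 < min δ (min a b) := lt_min hδ (lt_min ha.1 hb.1)
  filter_upwards [Metric.ball_mem_nhds _ hm] with x hx
  rw [mem_ball_zero_iff, lt_min_iff, lt_min_iff] at hx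
  constructor
  · rintro ⟨r, hr, rfl⟩
    rw [h₁.norm_eq r ⟨hr.1, hr.2.le.trans ha.2⟩] at hx
    exact ⟨r, ⟨hr.1, hx.2.2⟩, (heq0 r ⟨hr.1, hx.1⟩).symm⟩
  · rintro ⟨r, hr, rfl⟩
    rw [h₂.norm_eq r ⟨hr.1, hr.2.le.trans hb.2⟩] at hx
    exact ⟨r, ⟨hr.1, hx.2.1⟩, heq0 r ⟨hr.1, hx.1⟩⟩

theorem IsRadialCurve.eventually_eq_or_ne {n : ℕ} {σ₁ σ₂ : ℝ → EuclideanSpace ℝ (Fin n)} {R : ℝ}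
    (h₁ : IsRadialCurve σ₁ R) (h₂ : IsRadialCurve σ₂ R) :
    (∀ᶠ r in 𝓝[>] (0 : ℝ), σ₁ r = σ₂ r) ∨ ∀ᶠ r in 𝓝[>] (0 : ℝ), σ₁ r ≠ σ₂ r := by
  have hd := fun i =>
    ((h₁.isAlgebraicGerm i).sub (h₂.isAlgebraicGerm i)).eventually_eq_zero_or_ne_zero
  by_cases hall : ∀ i, ∀ᶠ r in 𝓝[>] (0 : ℝ), σ₁ r i - σ₂ r i = 0
  · left
    filter_upwards [eventually_all.2 hall] with r hr
    ext i
    exact sub_eq_zero.1 (hr i)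
  · right
    rw [not_forall] at hall
    obtain ⟨i, hi⟩ := hall
    filter_upwards [(hd i).resolve_left hi] with r hr heq
    exact hr (by rw [heq, sub_self])

/-- Two arcs that are tangent at the origin and meet only there do not form a normally embedded
germ: a path between points of the two arcs has to pass through the origin. -/
theorem IsRadialCurve.not_isGermLNE {n : ℕ} {σ₁ σ₂ : ℝ → EuclideanSpace ℝ (Fin n)} {R a b : ℝ}
    (h₁ : IsRadialCurve σ₁ R) (h₂ : IsRadialCurve σ₂ R) (hne : ∀ r ∈ Ioc 0 R, σ₁ r ≠ σ₂ r)
    {v : EuclideanSpace ℝ (Fin n)}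
    (hv₁ : ∀ η > 0, ∃ δ > 0, ∀ r ∈ Ico 0 δ, ‖σ₁ r - r • v‖ ≤ η * r)
    (hv₂ : ∀ η > 0, ∃ δ > 0, ∀ r ∈ Ico 0 δ, ‖σ₂ r - r • v‖ ≤ η * r)
    (ha : a ∈ Ioc 0 R) (hb : b ∈ Ioc 0 R) :
    ¬ IsGermLNE (σ₁ '' Ico 0 a ∪ σ₂ '' Ico 0 b) 0 := by
  rintro ⟨U, hU, C, hC, hLNE⟩
  obtain ⟨δ, hδ, hδU⟩ := Metric.mem_nhds_iff.1 hU
  -- This tolerance gives `C * dist (σ₁ r) (σ₂ r) ≤ r / 2`, against the lower bound `r` for the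
  -- length.
  have hη : 0 < 1 / (4 * ((C : ℝ) + 1)) := by positivity
  obtain ⟨δ₁, hδ₁, hv₁⟩ := hv₁ _ hη
  obtain ⟨δ₂, hδ₂, hv₂⟩ := hv₂ _ hη
  obtain ⟨r, hr0, hr⟩ : ∃ r, 0 < r ∧ r < min (min δ (min δ₁ δ₂)) (min a b) :=
    exists_between (lt_min (lt_min hδ (lt_min hδ₁ hδ₂)) (lt_min ha.1 hb.1))
  simp only [lt_min_iff] at hr
  obtain ⟨⟨hrδ, hrδ₁, hrδ₂⟩, hra, hrb⟩ := hr
  have hrR : r ∈ Icc 0 R := ⟨hr0.le, hra.le.trans ha.2⟩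
  have hx : σ₁ r ∈ (σ₁ '' Ico 0 a ∪ σ₂ '' Ico 0 b) ∩ U :=
    ⟨.inl ⟨r, ⟨hr0.le, hra⟩, rfl⟩, hδU (by rwa [mem_ball_zero_iff, h₁.norm_eq r hrR])⟩
  have hy : σ₂ r ∈ (σ₁ '' Ico 0 a ∪ σ₂ '' Ico 0 b) ∩ U :=
    ⟨.inr ⟨r, ⟨hr0.le, hrb⟩, rfl⟩, hδU (by rwa [mem_ball_zero_iff, h₂.norm_eq r hrR])⟩
  have hle := hLNE _ hx _ hy
  have hlow : ENNReal.ofReal r ≤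
      innerEDist ((σ₁ '' Ico 0 a ∪ σ₂ '' Ico 0 b) ∩ U) (σ₁ r) (σ₂ r) := by
    refine le_iInf fun c => le_iInf fun hc => le_iInf fun hmap => le_iInf fun h0 =>
      le_iInf fun h1 => ?_
    -- The path is connected and covered by two closed arcs, so it meets their intersection. A
    -- common point has the same radius on both arcs, hence is `0`.
    have hclosed₁ : IsClosed (σ₁ '' Icc 0 R) :=
      (isCompact_Icc.image_of_continuousOn h₁.continuousOn).isClosed
    have hclosed₂ : IsClosed (σ₂ '' Icc 0 R) :=
      (isCompact_Icc.image_of_continuousOn h₂.continuousOn).isClosed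
    have hpre := isPreconnected_closed_iff.1 (isPreconnected_Icc.image c hc) _ _ hclosed₁ hclosed₂
      (by
        rintro _ ⟨u, hu, rfl⟩
        refine (hmap hu).1.imp ?_ ?_
        · exact fun ⟨t, ht, h⟩ => ⟨t, ⟨ht.1, ht.2.le.trans ha.2⟩, h⟩
        · exact fun ⟨t, ht, h⟩ => ⟨t, ⟨ht.1, ht.2.le.trans hb.2⟩, h⟩)
      ⟨σ₁ r, ⟨0, by simp, h0⟩, r, hrR, rfl⟩ ⟨σ₂ r, ⟨1, by simp, h1⟩, r, hrR, rfl⟩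
    obtain ⟨_, ⟨u, hu, rfl⟩, ⟨p, hp, hpu⟩, q, hq, hqu⟩ := hpre
    have hpq : p = q := by rw [← h₁.norm_eq p hp, hpu, ← h₂.norm_eq q hq, hqu]
    subst hpq
    have hp0 : p = 0 := by
      by_contra hp0
      exact hne p ⟨hp.1.lt_of_ne' hp0, hp.2⟩ (hpu.trans hqu.symm)
    have hcu : c u = 0 := by rw [← hpu, ← norm_eq_zero, h₁.norm_eq p hp, hp0]
    have := eVariationOn.edist_le c (s := Icc 0 1) (left_mem_Icc.2 zero_le_one) hu
    rwa [hcu, h0, edist_dist, dist_zero_right, h₁.norm_eq r hrR] at this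
  have hdist : dist (σ₁ r) (σ₂ r) ≤ 2 * (1 / (4 * ((C : ℝ) + 1)) * r) := by
    have e₁ := hv₁ r ⟨hr0.le, hrδ₁⟩
    have e₂ := hv₂ r ⟨hr0.le, hrδ₂⟩
    have := norm_sub_le (σ₁ r - r • v) (σ₂ r - r • v)
    rw [sub_sub_sub_cancel_right] at this
    rw [dist_eq_norm]
    linarith
  have hfin := hlow.trans hle
  rw [edist_dist, ← ENNReal.ofReal_coe_nnreal, ← ENNReal.ofReal_mul C.coe_nonneg,
    ENNReal.ofReal_le_ofReal_iff (mul_nonneg C.coe_nonneg dist_nonneg)] at hfin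
  have h2 : (C : ℝ) * dist (σ₁ r) (σ₂ r) ≤ C * (2 * (1 / (4 * ((C : ℝ) + 1)) * r)) :=
    mul_le_mul_of_nonneg_left hdist C.coe_nonneg
  have h3 : (C : ℝ) * (2 * (1 / (4 * ((C : ℝ) + 1)) * r)) = (C / (C + 1)) * (r / 2) := by
    field_simp
    ring
  have h4 : (C : ℝ) / (C + 1) ≤ 1 := (div_le_one (by positivity)).2 (by linarith)
  nlinarith

/-! ### Arc length against chord, and arcs with different tangents -/

theorem eVariationOn_euclideanSpace_le {n : ℕ} (σ : ℝ → EuclideanSpace ℝ (Fin n)) (s : Set ℝ) :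
    eVariationOn σ s ≤ ∑ i, eVariationOn (fun r => σ r i) s := by
  refine iSup_le fun ⟨N, u, hu, hus⟩ => ?_
  have hle : ∀ x y : EuclideanSpace ℝ (Fin n), edist x y ≤ ∑ i, edist (x i) (y i) := by
    intro x y
    simp only [edist_dist]
    rw [← ENNReal.ofReal_sum_of_nonneg fun _ _ => dist_nonneg]
    refine ENNReal.ofReal_le_ofReal ?_
    rw [EuclideanSpace.dist_eq]
    refine Real.sqrt_le_iff.2 ⟨Finset.sum_nonneg fun _ _ => dist_nonneg, ?_⟩
    exact Finset.sum_sq_le_sq_sum_of_nonneg fun _ _ => dist_nonneg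
  calc ∑ k ∈ Finset.range N, edist (σ (u (k + 1))) (σ (u k))
      ≤ ∑ k ∈ Finset.range N, ∑ i, edist (σ (u (k + 1)) i) (σ (u k) i) :=
        Finset.sum_le_sum fun k _ => hle _ _
    _ = ∑ i, ∑ k ∈ Finset.range N, edist (σ (u (k + 1)) i) (σ (u k) i) := Finset.sum_comm
    _ ≤ ∑ i, eVariationOn (fun r => σ r i) s := Finset.sum_le_sum fun i _ =>
        eVariationOn.sum_le (f := fun r => σ r i) hu hus

theorem eVariationOn_Icc_eq_edist {f : ℝ → ℝ} {p q : ℝ} (hpq : p ≤ q)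
    (hf : MonotoneOn f (Icc p q) ∨ AntitoneOn f (Icc p q)) :
    eVariationOn f (Icc p q) = edist (f p) (f q) := by
  have key : ∀ g : ℝ → ℝ, MonotoneOn g (Icc p q) →
      eVariationOn g (Icc p q) = edist (g p) (g q) := by
    intro g hg
    have := hg.eVariationOn_eq (left_mem_Icc.2 hpq) (right_mem_Icc.2 hpq)
    rw [inter_self] at this
    rw [this, edist_comm, edist_dist, Real.dist_eq, abs_of_nonneg
      (sub_nonneg.2 (hg (left_mem_Icc.2 hpq) (right_mem_Icc.2 hpq) hpq))]
  rcases hf with hf | hf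
  · exact key f hf
  · have := key (-f) hf.neg
    simpa [eVariationOn] using this

/-- Each coordinate is monotone, so its variation is the difference of its end values, which the
chord bounds. -/
theorem IsRadialCurve.eVariationOn_le {n : ℕ} {σ : ℝ → EuclideanSpace ℝ (Fin n)} {R p q : ℝ}
    (h : IsRadialCurve σ R) (hp : 0 ≤ p) (hpq : p ≤ q) (hq : q ≤ R) :
    eVariationOn σ (Icc p q) ≤ n * edist (σ p) (σ q) := by
  refine (eVariationOn_euclideanSpace_le σ _).trans ?_
  calc ∑ i, eVariationOn (fun r => σ r i) (Icc p q) ≤ ∑ _i : Fin n, edist (σ p) (σ q) := by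
        refine Finset.sum_le_sum fun i _ => ?_
        rw [eVariationOn_Icc_eq_edist hpq ((h.monotoneOn_or i).imp
          (·.mono (Icc_subset_Icc hp hq)) (·.mono (Icc_subset_Icc hp hq)))]
        simp only [edist_dist]
        refine ENNReal.ofReal_le_ofReal ?_
        rw [dist_eq_norm, dist_eq_norm]
        exact PiLp.norm_apply_le (σ p - σ q) i
    _ = n * edist (σ p) (σ q) := by simp

theorem isLNE_image_of_eVariationOn_le {n : ℕ} {τ : ℝ → EuclideanSpace ℝ (Fin n)} {s : Set ℝ}
    [OrdConnected s] (hc : ContinuousOn τ s) {C : ℝ≥0} (hC : 0 < C)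
    (h : ∀ p ∈ s, ∀ q ∈ s, p ≤ q → eVariationOn τ (Icc p q) ≤ C * edist (τ p) (τ q)) :
    IsLNE (τ '' s) := by
  refine ⟨C, hC, ?_⟩
  rintro _ ⟨p, hp, rfl⟩ _ ⟨q, hq, rfl⟩
  set φ : ℝ → ℝ := fun u => p + u * (q - p) with hφ
  have hφs : MapsTo φ (Icc 0 1) (uIcc p q) := by
    intro u hu
    rcases le_total p q with hpq | hpq
    · rw [uIcc_of_le hpq]
      exact ⟨by nlinarith [hu.1], by nlinarith [hu.2]⟩
    · rw [uIcc_of_ge hpq]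
      exact ⟨by nlinarith [hu.2], by nlinarith [hu.1]⟩
  have hsub : uIcc p q ⊆ s := OrdConnected.uIcc_subset ‹_› hp hq
  have hφc : Continuous φ := by fun_prop
  have hpath : eVariationOn (τ ∘ φ) (Icc 0 1) ≤ C * edist (τ p) (τ q) := by
    rcases le_total p q with hpq | hpq
    · refine le_trans (eVariationOn.comp_le_of_monotoneOn τ φ ?_ hφs) ?_
      · exact fun u _ w _ huw => by simp only [hφ]; nlinarith
      · rw [uIcc_of_le hpq]
        exact h p hp q hq hpq
    · refine le_trans (eVariationOn.comp_le_of_antitoneOn τ φ ?_ hφs) ?_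
      · exact fun u _ w _ huw => by simp only [hφ]; nlinarith
      · rw [uIcc_of_ge hpq, edist_comm]
        exact h q hq p hp hpq
  refine le_trans ?_ hpath
  refine iInf_le_of_le (τ ∘ φ) (iInf_le_of_le ?_ (iInf_le_of_le ?_ (iInf_le_of_le ?_
    (iInf_le_of_le ?_ le_rfl))))
  · exact (hc.mono hsub).comp hφc.continuousOn hφs
  · exact fun u hu => mem_image_of_mem τ (hsub (hφs hu))
  · simp [hφ]
  · simp [hφ]

/-- The reverse triangle inequality bounds `|p - q|` by `‖p • v - q • w‖`. Replacing one coefficient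
by the other costs `|p - q|`, so `p * ‖v - w‖` and `q * ‖v - w‖` are each at most twice that norm.
-/
theorem add_mul_norm_sub_le_four_mul {E : Type*} [NormedAddCommGroup E] [NormedSpace ℝ E] {v w : E}
    (hv : ‖v‖ = 1) (hw : ‖w‖ = 1) {p q : ℝ} (hp : 0 ≤ p) (hq : 0 ≤ q) :
    (p + q) * ‖v - w‖ ≤ 4 * ‖p • v - q • w‖ := by
  have h1 : |p - q| ≤ ‖p • v - q • w‖ := by
    have := abs_norm_sub_norm_le (p • v) (q • w)
    rwa [norm_smul, norm_smul, hv, hw, mul_one, mul_one, Real.norm_of_nonneg hp,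
      Real.norm_of_nonneg hq] at this
  have h2 : p * ‖v - w‖ ≤ ‖p • v - q • w‖ + |p - q| := by
    have e : p • (v - w) = (p • v - q • w) - (p - q) • w := by module
    have := norm_sub_le (p • v - q • w) ((p - q) • w)
    rw [← e, norm_smul, norm_smul, hw, mul_one, Real.norm_of_nonneg hp, Real.norm_eq_abs] at this
    exact this
  have h3 : q * ‖v - w‖ ≤ ‖p • v - q • w‖ + |p - q| := by
    have e : q • (v - w) = (p • v - q • w) - (p - q) • v := by module
    have := norm_sub_le (p • v - q • w) ((p - q) • v)
    rw [← e, norm_smul, norm_smul, hv, mul_one, Real.norm_of_nonneg hq, Real.norm_eq_abs] at this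
    exact this
  linarith

/-- The union of two arcs starting at the origin in different directions is normally embedded. -/
theorem IsRadialCurve.isGermLNE {n : ℕ} {σ₁ σ₂ : ℝ → EuclideanSpace ℝ (Fin n)} {R a b : ℝ}
    (h₁ : IsRadialCurve σ₁ R) (h₂ : IsRadialCurve σ₂ R) {v₁ v₂ : EuclideanSpace ℝ (Fin n)}
    (hn₁ : ‖v₁‖ = 1) (hn₂ : ‖v₂‖ = 1) (hne : v₁ ≠ v₂)
    (hv₁ : ∀ η > 0, ∃ δ > 0, ∀ r ∈ Ico 0 δ, ‖σ₁ r - r • v₁‖ ≤ η * r)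
    (hv₂ : ∀ η > 0, ∃ δ > 0, ∀ r ∈ Ico 0 δ, ‖σ₂ r - r • v₂‖ ≤ η * r)
    (ha : a ∈ Ioc 0 R) (hb : b ∈ Ioc 0 R) :
    IsGermLNE (σ₁ '' Ico 0 a ∪ σ₂ '' Ico 0 b) 0 := by
  have hd : 0 < ‖v₁ - v₂‖ := norm_pos_iff.2 (sub_ne_zero.2 hne)
  -- With `1/8`, the errors total at most half of the separation `(p + q) * ‖v₁ - v₂‖ / 4` of the
  -- tangent rays.
  obtain ⟨δ₁, hδ₁, hv₁⟩ := hv₁ (‖v₁ - v₂‖ / 8) (by positivity)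
  obtain ⟨δ₂, hδ₂, hv₂⟩ := hv₂ (‖v₁ - v₂‖ / 8) (by positivity)
  set r := min (min a b) (min δ₁ δ₂) with hr
  have hr0 : 0 < r := lt_min (lt_min ha.1 hb.1) (lt_min hδ₁ hδ₂)
  have hra : r ≤ a := (min_le_left _ _).trans (min_le_left _ _)
  have hrb : r ≤ b := (min_le_left _ _).trans (min_le_right _ _)
  have hrδ₁ : r ≤ δ₁ := (min_le_right _ _).trans (min_le_left _ _)
  have hrδ₂ : r ≤ δ₂ := (min_le_right _ _).trans (min_le_right _ _)
  have hrR : r ≤ R := hra.trans ha.2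
  have hσ₁0 : σ₁ 0 = 0 := norm_eq_zero.1 (h₁.norm_eq 0 ⟨le_rfl, h₁.pos.le⟩)
  have hσ₂0 : σ₂ 0 = 0 := norm_eq_zero.1 (h₂.norm_eq 0 ⟨le_rfl, h₂.pos.le⟩)
  -- The two arcs become one curve through `0`, with the second arc on negative parameters.
  set τ : ℝ → EuclideanSpace ℝ (Fin n) := fun t => if 0 ≤ t then σ₁ t else σ₂ (-t) with hτ
  have hτ₁ : ∀ t, 0 ≤ t → τ t = σ₁ t := fun t ht => by simp [hτ, ht]
  have hτ₂ : ∀ t, t ≤ 0 → τ t = (σ₂ ∘ Neg.neg) t := fun t ht => by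
    rcases ht.eq_or_lt with rfl | h
    · simp [hτ, hσ₁0, hσ₂0]
    · simp [hτ, h.not_ge]
  have hset : (σ₁ '' Ico 0 a ∪ σ₂ '' Ico 0 b) ∩ Metric.ball 0 r = τ '' Ioo (-r) r := by
    ext x
    rw [mem_inter_iff, mem_ball_zero_iff]
    constructor
    · rintro ⟨⟨t, ht, rfl⟩ | ⟨t, ht, rfl⟩, hx⟩
      · rw [h₁.norm_eq t ⟨ht.1, ht.2.le.trans ha.2⟩] at hx
        exact ⟨t, ⟨by linarith [ht.1], hx⟩, hτ₁ t ht.1⟩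
      · rw [h₂.norm_eq t ⟨ht.1, ht.2.le.trans hb.2⟩] at hx
        exact ⟨-t, ⟨by linarith, by linarith [ht.1]⟩, by simp [hτ₂ (-t) (by linarith [ht.1])]⟩
    · rintro ⟨t, ht, rfl⟩
      rcases le_total 0 t with h0 | h0
      · rw [hτ₁ t h0, h₁.norm_eq t ⟨h0, ht.2.le.trans hrR⟩]
        exact ⟨.inl ⟨t, ⟨h0, ht.2.trans_le hra⟩, rfl⟩, ht.2⟩
      · have h1 : -t < r := by linarith [ht.1]
        rw [hτ₂ t h0, Function.comp_apply, h₂.norm_eq (-t) ⟨by linarith, h1.le.trans hrR⟩]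
        exact ⟨.inr ⟨-t, ⟨by linarith, h1.trans_le hrb⟩, rfl⟩, h1⟩
  refine ⟨Metric.ball 0 r, Metric.ball_mem_nhds 0 hr0, ?_⟩
  rw [hset]
  have hcont : ContinuousOn τ (Ioo (-r) r) := by
    have hc₁ : ContinuousOn τ (Icc 0 r) :=
      (h₁.continuousOn.mono (Icc_subset_Icc_right hrR)).congr fun t ht => hτ₁ t ht.1
    have hc₂ : ContinuousOn τ (Icc (-r) 0) := by
      refine ContinuousOn.congr ?_ fun t ht => hτ₂ t ht.2
      exact h₂.continuousOn.comp continuous_neg.continuousOn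
        fun t ht => ⟨by linarith [ht.2], by linarith [ht.1]⟩
    refine (hc₂.union_of_isClosed hc₁ isClosed_Icc isClosed_Icc).mono ?_
    rw [Icc_union_Icc_eq_Icc (by linarith) hr0.le]
    exact Ioo_subset_Icc_self
  have hvar₁ : ∀ p q, 0 ≤ p → p ≤ q → q ≤ r →
      eVariationOn τ (Icc p q) ≤ n * edist (τ p) (τ q) := by
    intro p q hp hpq hq
    rw [eVariationOn.congr fun t ht => hτ₁ t (hp.trans ht.1), hτ₁ p hp, hτ₁ q (hp.trans hpq)]
    exact h₁.eVariationOn_le hp hpq (hq.trans hrR)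
  have hvar₂ : ∀ p q, -r ≤ p → p ≤ q → q ≤ 0 →
      eVariationOn τ (Icc p q) ≤ n * edist (τ p) (τ q) := by
    intro p q hp hpq hq
    rw [eVariationOn.congr fun t ht => hτ₂ t (ht.2.trans hq), hτ₂ p (hpq.trans hq), hτ₂ q hq,
      edist_comm]
    refine (eVariationOn.comp_le_of_antitoneOn σ₂ Neg.neg
      (fun x _ y _ hxy => neg_le_neg hxy) (s := Icc (-q) (-p))
      fun t ht => ⟨neg_le_neg ht.2, neg_le_neg ht.1⟩).trans ?_
    exact h₂.eVariationOn_le (by linarith) (by linarith) (by linarith)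
  -- The first term serves pairs on the same arc, the second pairs on different arcs; the `1` only
  -- ensures positivity.
  set K : ℝ≥0 := n + n * (8 / ‖v₁ - v₂‖₊) + 1 with hK
  have hnK : (n : ℝ≥0∞) ≤ K := by
    have : (n : ℝ≥0) ≤ K := by rw [hK, add_assoc]; exact le_self_add
    exact_mod_cast this
  refine isLNE_image_of_eVariationOn_le hcont (C := K) (by positivity) fun p hp q hq hpq => ?_
  rcases le_total 0 p with h0p | hp0
  · exact (hvar₁ p q h0p hpq hq.2.le).trans (mul_le_mul_left hnK _)
  rcases le_total q 0 with hq0 | h0q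
  · exact (hvar₂ p q hp.1.le hpq hq0).trans (mul_le_mul_left hnK _)
  have hsplit := eVariationOn.Icc_add_Icc τ (s := univ) hp0 h0q (mem_univ _)
  simp only [univ_inter] at hsplit
  have hp' : -p ∈ Ico 0 r := ⟨by linarith, by linarith [hp.1]⟩
  have hq' : q ∈ Ico 0 r := ⟨h0q, hq.2⟩
  have hnp : ‖τ p‖ = -p := by
    rw [hτ₂ p hp0]; exact h₂.norm_eq _ ⟨hp'.1, hp'.2.le.trans hrR⟩
  have hnq : ‖τ q‖ = q := by
    rw [hτ₁ q h0q]; exact h₁.norm_eq _ ⟨hq'.1, hq'.2.le.trans hrR⟩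
  have hτ0 : τ 0 = 0 := by rw [hτ₁ 0 le_rfl, hσ₁0]
  have hsep : (q + -p) ≤ (8 / ‖v₁ - v₂‖) * dist (τ p) (τ q) := by
    have e₁ := hv₁ q ⟨hq'.1, hq'.2.trans_le hrδ₁⟩
    have e₂ := hv₂ (-p) ⟨hp'.1, hp'.2.trans_le hrδ₂⟩
    have e₃ := add_mul_norm_sub_le_four_mul hn₁ hn₂ hq'.1 hp'.1
    rw [dist_comm, dist_eq_norm, hτ₁ q h0q, hτ₂ p hp0, Function.comp_apply]
    have e₄ : q • v₁ - (-p) • v₂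
        = (σ₁ q - σ₂ (-p)) - ((σ₁ q - q • v₁) - (σ₂ (-p) - (-p) • v₂)) := by module
    have e₅ := norm_sub_le (σ₁ q - σ₂ (-p)) ((σ₁ q - q • v₁) - (σ₂ (-p) - (-p) • v₂))
    have e₆ := norm_sub_le (σ₁ q - q • v₁) (σ₂ (-p) - (-p) • v₂)
    rw [← e₄] at e₅
    rw [div_mul_eq_mul_div, le_div_iff₀ hd]
    linarith
  calc eVariationOn τ (Icc p q)
      ≤ n * edist (τ p) (τ 0) + n * edist (τ 0) (τ q) := by
        rw [← hsplit]
        exact add_le_add (hvar₂ p 0 hp.1.le hp0 le_rfl) (hvar₁ 0 q le_rfl h0q hq.2.le)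
    _ = n * ENNReal.ofReal (q + -p) := by
        rw [hτ0, edist_comm 0, edist_dist, edist_dist, dist_zero_right, dist_zero_right, hnp, hnq,
          ← mul_add, ← ENNReal.ofReal_add hp'.1 hq'.1, add_comm]
    _ ≤ n * ENNReal.ofReal ((8 / ‖v₁ - v₂‖) * dist (τ p) (τ q)) :=
        mul_le_mul_right (ENNReal.ofReal_le_ofReal hsep) _
    _ = ((n * (8 / ‖v₁ - v₂‖₊) : ℝ≥0) : ℝ≥0∞) * edist (τ p) (τ q) := by
        rw [ENNReal.ofReal_mul (by positivity), ← edist_dist, ENNReal.coe_mul, mul_assoc]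
        congr 2
        rw [← ENNReal.ofReal_coe_nnreal]
        simp
    _ ≤ K * edist (τ p) (τ q) := by
        refine mul_le_mul_left (ENNReal.coe_le_coe.2 ?_) _
        rw [hK, add_right_comm]
        exact le_add_self

/-! ### The equivalence for two semialgebraic curves -/

theorem mainTheorem3 (n : ℕ) (γ₁ γ₂ : ℝ → EuclideanSpace ℝ (Fin n))
    (h₁ : IsSemialgebraicCurve γ₁) (h₂ : IsSemialgebraicCurve γ₂)
    (hn₁ : NonconstantGerm γ₁) (hn₂ : NonconstantGerm γ₂)
    (hne : ¬ ∀ᶠ ε in 𝓝[>] (0 : ℝ), SameGermAt (arc γ₁ ε) (arc γ₂ ε) 0) :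
    ∃ l₁ l₂ : Set (EuclideanSpace ℝ (Fin n)),
      (∃ v₁, v₁ ≠ 0 ∧ l₁ = halfLine v₁) ∧ (∃ v₂, v₂ ≠ 0 ∧ l₂ = halfLine v₂) ∧
      ∀ᶠ ε in 𝓝[>] (0 : ℝ),
        peanoTangentCone (arc γ₁ ε) 0 = l₁ ∧ peanoTangentCone (arc γ₂ ε) 0 = l₂ ∧
        (IsGermLNE (arc γ₁ ε ∪ arc γ₂ ε) 0 ↔ l₁ ≠ l₂) := by
  obtain ⟨σ₁, R₁, hσ₁, harc₁⟩ := h₁.exists_isRadialCurve hn₁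
  obtain ⟨σ₂, R₂, hσ₂, harc₂⟩ := h₂.exists_isRadialCurve hn₂
  have hR : 0 < min R₁ R₂ := lt_min hσ₁.pos hσ₂.pos
  have hdis : ∀ᶠ r in 𝓝[>] (0 : ℝ), σ₁ r ≠ σ₂ r := by
    have hσ₁' := hσ₁.mono hR (min_le_left _ _)
    have hσ₂' := hσ₂.mono hR (min_le_right _ _)
    refine (hσ₁'.eventually_eq_or_ne hσ₂').resolve_left fun heq => hne ?_
    filter_upwards [harc₁ _ hR (min_le_left _ _), harc₂ _ hR (min_le_right _ _)]
      with ε ⟨a, ha, hea⟩ ⟨b, hb, heb⟩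
    rw [hea, heb]
    exact hσ₁'.sameGermAt hσ₂' heq ha hb
  obtain ⟨δ, hδ, hdis⟩ := eventually_nhdsGT_zero_iff.1 hdis
  -- Halving `δ` makes the arcs differ at every radius in the half-closed interval `Ioc 0 R`.
  set R := min (min R₁ R₂) (δ / 2) with hRdef
  have hR0 : 0 < R := lt_min hR (by positivity)
  have hRR₁ : R ≤ R₁ := (min_le_left _ _).trans (min_le_left _ _)
  have hRR₂ : R ≤ R₂ := (min_le_left _ _).trans (min_le_right _ _)
  have hRδ : R < δ := (min_le_right _ _).trans_lt (by linarith)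
  obtain ⟨v₁, hv₁, hdir₁⟩ := hσ₁.exists_direction
  obtain ⟨v₂, hv₂, hdir₂⟩ := hσ₂.exists_direction
  refine ⟨halfLine v₁, halfLine v₂, ⟨v₁, ?_, rfl⟩, ⟨v₂, ?_, rfl⟩, ?_⟩
  · rintro rfl; simp at hv₁
  · rintro rfl; simp at hv₂
  have hσ₁' := hσ₁.mono hR0 hRR₁
  have hσ₂' := hσ₂.mono hR0 hRR₂
  filter_upwards [harc₁ _ hR0 hRR₁, harc₂ _ hR0 hRR₂] with ε ⟨a, ha, hea⟩ ⟨b, hb, heb⟩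
  rw [hea, heb]
  refine ⟨hσ₁'.peanoTangentCone_eq hdir₁ ha.1 ha.2, hσ₂'.peanoTangentCone_eq hdir₂ hb.1 hb.2, ?_⟩
  rw [Ne, halfLine_eq_halfLine_iff hv₁ hv₂]
  refine ⟨fun hLNE hv => ?_, fun hv => hσ₁'.isGermLNE hσ₂' hv₁ hv₂ hv hdir₁ hdir₂ ha hb⟩
  subst hv
  exact hσ₁'.not_isGermLNE hσ₂' (fun r hr => hdis r ⟨hr.1, hr.2.trans_lt hRδ⟩) hdir₁ hdir₂ ha hb hLNE
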